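/- Let $\mathcal F$ be a signature (a set of function symbols with fixed arities) and $\mathcal V$ an infinite set of variables, and let $\mathcal T(\mathcal F,\mathcal V)$ be the set of terms. A \emph{context} is a term over $\mathcal F\cup\{\square\}$ and $\mathcal V$, where the hole $\square$ is a fresh constant. Contexts are ordered by $\sqsubseteq$, the least reflexive, transitive and monotone (closed under function application) relation with $\square\sqsubseteq C$ for all contexts $C$; $\sqcup$ denotes the corresponding partial binary supremum. For a context $C$, let $\mathrm{Pos}_{\mathcal F}(C)$ be the set of positions of $C$ that carry a symbol of $\mathcal F$. A TRS $\mathcal R$ over $\mathcal F$ is a set of rules $\ell\to r$ between terms such that $\ell$ is not a variable and every variable of $r$ occurs in $\ell$. We write $s\to_{p,\ell\to r}t$ for a rewrite step at position $p$ with rule $\ell\to r$, and $\to_{\mathcal R}$ for the rewrite relation of $\mathcal R$. A relation is confluent on a set $S$ if $S$ is closed under it and its restriction to $S$ is confluent. Let $\mathbb L$ be a set of contexts. A \emph{top} of a context $C$ is an $L\in\mathbb L$ with $L\sqsubseteq C$, and a \emph{max-top} is a $\sqsubseteq$-maximal top. $\mathbb L$ is a \emph{layer system} if (L1) each term has a top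 different from $\square$; (L2) for every variable $x$, context $C$ and position $p$ of $C$, $C[x]_p\in\mathbb L$ if and only if $C[\square]_p\in\mathbb L$; (L3) if $L,N\in\mathbb L$, $p\in\mathrm{Pos}_{\mathcal F}(L)$ and $L|_p\sqcup N$ is defined, then $L[L|_p\sqcup N]_p\in\mathbb L$. Then every term $t$ has a unique max-top $M$, and $M\ne\square$. Writing $t=M[t_1,\dots,t_n]$, put $\mathrm{rank}(t)=1+\max\{\mathrm{rank}(t_i)\mid 1\le i\le n\}$, where $\max\varnothing=0$. A TRS $\mathcal R$ is \emph{weakly layered} according to the layer system $\mathbb L$ if for each rule $\ell\to r$ of $\mathcal R$: whenever $M$ is the max-top of a term $s$, $p\in\mathrm{Pos}_{\mathcal F}(M)$ and $s\to_{p,\ell\to r}t$, then $M\to_{p,\ell\to r}L$ for some $L\in\mathbb L$. $\mathcal R$ is \emph{bounded duplicating} if, for a fresh unary symbol $\Diamond$, the relation $\to_{\mathcal R}^*\cdot\to_{\{\Diamond(x)\to x\}}\cdot\to_{\mathcal R}^*$ on the terms over $\mathcal F\cup\{\Diamond\}$ is terminating. $\mathcal R$ is \emph{non-duplicating} if for no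 rule $\ell\to r$ of $\mathcal R$ does a variable occur more often in $r$ than in $\ell$. \textbf{Theorem.} Let $\mathcal R$ be a TRS that is weakly layered according to a layer system $\mathbb L$ and confluent on the set of terms of rank one. If $\mathcal R$ is bounded duplicating, then $\mathcal R$ is confluent. In particular this covers non-duplicating systems: if $\mathcal R$ is non-duplicating, then $\mathcal R$ is bounded duplicating, and hence confluent. -/

import Mathlib

universe u v

namespace LayerTRS

/-- A signature: a set of function symbols, each with a fixed arity. -/
structure Signature where
  Sym : Type u
  arity : Sym → ℕ

/-- The signature extended by one fresh symbol `none` of arity `k`. -/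
def Signature.adjoin (S : Signature.{u}) (k : ℕ) : Signature.{u} where
  Sym := Option S.Sym
  arity f := f.elim k S.arity

/-- First-order terms over the signature `S` and the variables `V`. -/
inductive Term (S : Signature.{u}) (V : Type v) : Type (max u v)
  | var (x : V) : Term S V
  | app (f : S.Sym) (ts : Fin (S.arity f) → Term S V) : Term S V

namespace Term

variable {S : Signature.{u}} {V : Type v}

/-- The set of variables of a term. -/
def vars : Term S V → Set V
  | var x => {x}
  | app _ ts => ⋃ i, (ts i).vars

open Classical in
/-- The number of occurrences of the variable `x` in a term. -/
noncomputable def countVar (x : V) : Term S V → ℕ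
  | var y => if y = x then 1 else 0
  | app _ ts => ∑ i, (ts i).countVar x

/-- The number of symbols of a term. -/
def size : Term S V → ℕ
  | var _ => 1
  | app _ ts => 1 + ∑ i, (ts i).size

/-- Application of a substitution. -/
def subst (σ : V → Term S V) : Term S V → Term S V
  | var x => σ x
  | app f ts => app f fun i => (ts i).subst σ

/-- The subterm at a position, if the position exists. Positions are strings of argument indices,
counted from `0`; the empty string is the root. -/
def subtermAt : Term S V → List ℕ → Option (Term S V)
  | t, [] => some t
  | var _, _ :: _ => none
  | app f ts, i :: p => if h : i < S.arity f then (ts ⟨i, h⟩).subtermAt p else none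

/-- `p` is a position of `t`. -/
def IsPos (t : Term S V) (p : List ℕ) : Prop := (t.subtermAt p).isSome

/-- Replacement of the subterm at the position `p` of `t` by `s` (used only for positions `p`
of `t`). -/
def replaceAt : Term S V → List ℕ → Term S V → Term S V
  | _, [], s => s
  | var x, _ :: _, _ => var x
  | app f ts, i :: p, s => app f fun j => if j.val = i then (ts j).replaceAt p s else ts j

/-- A term over `S` seen as a term over the signature with one more symbol. -/
def lift (k : ℕ) : Term S V → Term (S.adjoin k) V
  | var x => var x
  | app f ts => app (S := S.adjoin k) (some f) fun i => (ts i).lift k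

theorem lift_ne_var {k : ℕ} {t : Term S V} (h : ∀ x, t ≠ var x) (x : V) : t.lift k ≠ var x := by
  cases t with
  | var y => exact absurd rfl (h y)
  | app f ts => intro h'; cases h'

theorem vars_lift (k : ℕ) (t : Term S V) : (t.lift k).vars = t.vars := by
  induction t with
  | var x => rfl
  | app f ts ih => exact Set.iUnion_congr ih

theorem size_pos (t : Term S V) : 0 < t.size := by
  cases t <;> simp [size]

theorem size_subtermAt_le {t u : Term S V} {p : List ℕ} (h : t.subtermAt p = some u) :
    u.size ≤ t.size := by
  induction p generalizing t with
  | nil => cases t <;> simp_all [subtermAt]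
  | cons i p ih =>
    cases t with
    | var x => simp [subtermAt] at h
    | app f ts =>
      simp only [subtermAt] at h
      split at h
      · rename_i hi
        have h1 := ih h
        have h2 : (ts ⟨i, hi⟩).size ≤ ∑ j, (ts j).size :=
          Finset.single_le_sum (f := fun j => (ts j).size) (fun _ _ => Nat.zero_le _)
            (Finset.mem_univ _)
        simp only [size]
        omega
      · simp at h

theorem size_subtermAt_lt {t u : Term S V} {p : List ℕ} (hp : p ≠ [])
    (h : t.subtermAt p = some u) : u.size < t.size := by
  cases p with
  | nil => exact absurd rfl hp
  | cons i p =>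
    cases t with
    | var x => simp [subtermAt] at h
    | app f ts =>
      simp only [subtermAt] at h
      split at h
      · rename_i hi
        have h1 := size_subtermAt_le h
        have h2 : (ts ⟨i, hi⟩).size ≤ ∑ j, (ts j).size :=
          Finset.single_le_sum (f := fun j => (ts j).size) (fun _ _ => Nat.zero_le _)
            (Finset.mem_univ _)
        simp only [size]
        omega
      · simp at h

end Term

/-! ### Rewriting -/

/-- A rewrite rule `lhs → rhs`. -/
structure Rule (S : Signature.{u}) (V : Type v) where
  lhs : Term S V
  rhs : Term S V
  lhs_ne_var : ∀ x, lhs ≠ Term.var x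
  vars_subset : rhs.vars ⊆ lhs.vars

/-- A term rewrite system over `S` and `V`: a set of rewrite rules. -/
abbrev TRS (S : Signature.{u}) (V : Type v) := Set (Rule S V)

/-- A rule over `S` seen as a rule over the signature with one more symbol. -/
def Rule.lift {S : Signature.{u}} {V : Type v} (k : ℕ) (ρ : Rule S V) : Rule (S.adjoin k) V where
  lhs := ρ.lhs.lift k
  rhs := ρ.rhs.lift k
  lhs_ne_var := Term.lift_ne_var ρ.lhs_ne_var
  vars_subset := by simpa only [Term.vars_lift] using ρ.vars_subset

variable {S : Signature.{u}} {V : Type v}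

/-- A TRS over `S` seen as a TRS over the signature with one more symbol. -/
def TRS.lift (k : ℕ) (R : TRS S V) : TRS (S.adjoin k) V := Rule.lift k '' R

/-- `s` rewrites to `t` by the rule `ρ` at the position `p`. -/
def StepAt (ρ : Rule S V) (p : List ℕ) (s t : Term S V) : Prop :=
  ∃ σ : V → Term S V,
    s.subtermAt p = some (ρ.lhs.subst σ) ∧ t = s.replaceAt p (ρ.rhs.subst σ)

/-- The rewrite relation of a TRS. -/
def TRS.Step (R : TRS S V) (s t : Term S V) : Prop := ∃ ρ ∈ R, ∃ p, StepAt ρ p s t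

/-- Confluence of a relation: `←* · →* ⊆ →* · ←*`. -/
def Confluent {α : Type*} (r : α → α → Prop) : Prop :=
  ∀ a b c, Relation.ReflTransGen r a b → Relation.ReflTransGen r a c →
    Relation.Join (Relation.ReflTransGen r) b c

/-- `r` is confluent on `A`: `A` is closed under `r`, and the restriction of `r` to `A` is
confluent. -/
def ConfluentOn {α : Type*} (r : α → α → Prop) (A : Set α) : Prop :=
  (∀ a b, a ∈ A → r a b → b ∈ A) ∧ Confluent fun a b => r a b ∧ a ∈ A ∧ b ∈ A

/-- Termination of a relation: there is no infinite sequence `a₀ → a₁ → ⋯`. -/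
def Terminating {α : Type*} (r : α → α → Prop) : Prop :=
  WellFounded fun b a => Relation.TransGen r a b

/-- The relative rewrite relation `R / R'`, which is `→_{R'}* · →_R · →_{R'}*`. -/
def RelStep (R R' : TRS S V) : Term S V → Term S V → Prop :=
  Relation.Comp (Relation.ReflTransGen R'.Step)
    (Relation.Comp R.Step (Relation.ReflTransGen R'.Step))

/-- The term `◊(t)`, where `◊` is the fresh unary symbol of `S.adjoin 1`. -/
def diamond (t : Term (S.adjoin 1) V) : Term (S.adjoin 1) V :=
  Term.app (S := S.adjoin 1) none fun _ => t

/-- The rule `◊(x) → x`. -/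
def diamondRule (x : V) : Rule (S.adjoin 1) V where
  lhs := diamond (Term.var x)
  rhs := Term.var x
  lhs_ne_var := by intro y h; cases h
  vars_subset := by
    intro y hy
    exact Set.mem_iUnion.2 ⟨⟨0, Nat.one_pos⟩, hy⟩

/-- The TRS `{◊(x) → x}`. As a set of rules it contains a copy of the rule for each name of the
variable `x`; all these copies induce the same rewrite relation. -/
def diamondTRS : TRS (S.adjoin 1) V := Set.range diamondRule

/-- `R` is bounded duplicating: `{◊(x) → x} / R` is terminating, as a relation on the terms over
the signature extended by the fresh unary symbol `◊`. -/
def BoundedDuplicating (R : TRS S V) : Prop :=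
  Terminating (RelStep diamondTRS (R.lift 1))

/-- No rule of `R` is duplicating. -/
def NonDuplicating (R : TRS S V) : Prop :=
  ∀ ρ ∈ R, ∀ x, ρ.rhs.countVar x ≤ ρ.lhs.countVar x

/-! ### Layer systems -/

/-- Contexts with an arbitrary number of holes: terms over the signature extended by a fresh
constant, the hole. -/
abbrev Ctx (S : Signature.{u}) (V : Type v) := Term (S.adjoin 0) V

/-- The hole, which is also the empty context. -/
def hole : Ctx S V := Term.app (S := S.adjoin 0) none fun i => i.elim0

/-- A term as a context without holes. -/
def Term.toCtx (t : Term S V) : Ctx S V := t.lift 0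

/-- The partial order `⊑` on contexts: the least reflexive, transitive and monotone relation with
`□ ⊑ C` for all `C`. -/
inductive Ctx.Le : Ctx S V → Ctx S V → Prop
  | hole_le (C : Ctx S V) : Ctx.Le hole C
  | refl (C : Ctx S V) : Ctx.Le C C
  | trans {C D E : Ctx S V} : Ctx.Le C D → Ctx.Le D E → Ctx.Le C E
  | app (f : (S.adjoin 0).Sym) (Cs Ds : Fin ((S.adjoin 0).arity f) → Ctx S V) :
      (∀ i, Ctx.Le (Cs i) (Ds i)) → Ctx.Le (Term.app f Cs) (Term.app f Ds)

/-- `C ⊔ D` is defined and equal to `E`. -/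
def Ctx.IsMerge (C D E : Ctx S V) : Prop :=
  Ctx.Le C E ∧ Ctx.Le D E ∧ ∀ E', Ctx.Le C E' → Ctx.Le D E' → Ctx.Le E E'

/-- `p` is a position of `C` that carries a function symbol of `S` (neither a variable nor the
hole). -/
def Ctx.IsFunPos (C : Ctx S V) (p : List ℕ) : Prop :=
  ∃ (f : S.Sym) (Cs : Fin (S.arity f) → Ctx S V),
    C.subtermAt p = some (Term.app (S := S.adjoin 0) (some f) Cs)

/-- `L` is a top of `C` according to `𝕃`. -/
def IsTop (𝕃 : Set (Ctx S V)) (L C : Ctx S V) : Prop := L ∈ 𝕃 ∧ Ctx.Le L C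

/-- `M` is a max-top of `C` according to `𝕃`. -/
def IsMaxTop (𝕃 : Set (Ctx S V)) (M C : Ctx S V) : Prop :=
  IsTop 𝕃 M C ∧ ∀ L, IsTop 𝕃 L C → Ctx.Le M L → L = M

/-- `𝕃` is a layer system. -/
structure IsLayerSystem (𝕃 : Set (Ctx S V)) : Prop where
  /-- (L1) -/
  exists_top : ∀ t : Term S V, ∃ L, IsTop 𝕃 L t.toCtx ∧ L ≠ hole
  /-- (L2) -/
  var_iff_hole : ∀ (x : V) (C : Ctx S V) (p : List ℕ), C.IsPos p →
    (C.replaceAt p (Term.var x) ∈ 𝕃 ↔ C.replaceAt p hole ∈ 𝕃)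
  /-- (L3) -/
  merge_mem : ∀ L ∈ 𝕃, ∀ N ∈ 𝕃, ∀ p, Ctx.IsFunPos L p → ∀ C, L.subtermAt p = some C →
    ∀ E, Ctx.IsMerge C N E → L.replaceAt p E ∈ 𝕃

/-- Condition (W): `R` is weakly layered according to the layer system `𝕃`. -/
def WeaklyLayered (R : TRS S V) (𝕃 : Set (Ctx S V)) : Prop :=
  ∀ ρ ∈ R, ∀ (s t : Term S V) (M : Ctx S V) (p : List ℕ),
    IsMaxTop 𝕃 M s.toCtx → Ctx.IsFunPos M p → StepAt ρ p s t →
      ∃ L ∈ 𝕃, StepAt (ρ.lift 0) p M L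

/-- `u` is an alien of `t`: with `M` the max-top of `t` and `t = M[t₁, …, tₙ]`, it is one of the
`tᵢ`. For a layer system the max-top of `t` exists, is unique and is not the hole; requiring
`M ≠ hole` makes aliens smaller than `t` for every set `𝕃`. -/
def IsAlien (𝕃 : Set (Ctx S V)) (u t : Term S V) : Prop :=
  ∃ M p, IsMaxTop 𝕃 M t.toCtx ∧ M ≠ hole ∧ M.subtermAt p = some hole ∧ t.subtermAt p = some u

theorem IsAlien.size_lt {𝕃 : Set (Ctx S V)} {u t : Term S V} (h : IsAlien 𝕃 u t) :
    u.size < t.size := by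
  obtain ⟨M, p, -, hM, hp, hu⟩ := h
  refine Term.size_subtermAt_lt ?_ hu
  rintro rfl
  apply hM
  cases M <;> simpa [Term.subtermAt] using hp

/-- The rank of a term: `1` plus the maximum of the ranks of its (finitely many) aliens, where the
maximum of the empty set is `0`. -/
noncomputable def rank (𝕃 : Set (Ctx S V)) (t : Term S V) : ℕ :=
  1 + sSup {k | ∃ u, ∃ _h : IsAlien 𝕃 u t, k = rank 𝕃 u}
termination_by t.size
decreasing_by exact _h.size_lt

end LayerTRS

-- The proof is by induction on the rank. A term `s` of rank at most `r + 1` is split into its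
-- max-top and its aliens; aliens of rank exactly `r` stay sealed in boxes, aliens of smaller rank
-- are opened (`shorten`). Since (L2) lets holes turn into variables, replacing every box by a
-- variable gives a term of rank at most `r` (`IsMax.rank_shorten_rename_le`), which is confluent by
-- induction. Boxes with joinable contents get the same variable (`joinSetoid`, `cls`), so steps
-- inside boxes become invisible and non-left-linear rules remain applicable.
--
-- By (W) and the definition of boxes, each step from a term acts on its maximal decomposition or
-- inside one box (`IsMax.step`). The decomposition can thus follow a reduction as long as it agrees
-- with the shortened maximal decomposition of the current term. It stops agreeing when boxes have
-- to be opened, because the max-top has absorbed them or their contents have dropped in rank.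
-- Otherwise nothing happens to a box, as `IsMax.exists_simulates` shows. If boxes are marked by
-- `◊`, an opening is a step `◊(x) → x` after some steps of `R`, so bounded duplication provides a
-- second, inner well-founded induction.
--
-- Given a peak at `s`, both reductions are followed up to the first opening, to decompositions `A₁`
-- and `A₂`. Confluence of the term with named boxes, together with common reducts of joinable
-- contents (`exists_section`), gives a common reduct `c` of their underlying terms. Each end of the
-- peak is either the underlying term of its `Aᵢ`, or a reduct of it while that term is confluent by
-- the inner induction; in all cases the peak closes (`confluentAt_succ`).
--
-- For non-duplicating systems the number of symbols `◊` proves termination.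

universe w w'

namespace LayerTRS

/-! ### Terms over varying sets of variables and signatures -/

namespace Term

variable {S : Signature.{u}} {V : Type v} {W : Type w} {X : Type w'}

/-- Simultaneous replacement of variables by terms over another set of variables. -/
def bind (σ : V → Term S W) : Term S V → Term S W
  | var x => σ x
  | app f ts => app f fun i => (ts i).bind σ

/-- Replacement of variables by terms over a signature with one more symbol. -/
def liftBind (k : ℕ) (σ : W → Term (S.adjoin k) V) : Term S W → Term (S.adjoin k) V
  | var x => σ x
  | app f ts => app (S := S.adjoin k) (some f) fun i => (ts i).liftBind k σ

theorem subst_eq_bind (σ : V → Term S V) (t : Term S V) : t.subst σ = t.bind σ := by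
  induction t with
  | var x => rfl
  | app f ts ih => simp only [subst, bind, ih]

theorem bind_var (t : Term S V) : t.bind var = t := by
  induction t with
  | var x => rfl
  | app f ts ih => simp only [bind, ih]

theorem bind_bind (σ : V → Term S W) (τ : W → Term S X) (t : Term S V) :
    (t.bind σ).bind τ = t.bind fun x => (σ x).bind τ := by
  induction t with
  | var x => rfl
  | app f ts ih => simp only [bind, ih]

theorem liftBind_bind (k : ℕ) (σ : V → Term S W) (τ : W → Term (S.adjoin k) X) (t : Term S V) :
    (t.bind σ).liftBind k τ = t.liftBind k fun x => (σ x).liftBind k τ := by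
  induction t with
  | var x => rfl
  | app f ts ih => exact congrArg (app (S := S.adjoin k) (some f)) (funext ih)

theorem bind_liftBind (k : ℕ) (σ : V → Term (S.adjoin k) W) (τ : W → Term (S.adjoin k) X)
    (t : Term S V) : (t.liftBind k σ).bind τ = t.liftBind k fun x => (σ x).bind τ := by
  induction t with
  | var x => rfl
  | app f ts ih => exact congrArg (app (S := S.adjoin k) (some f)) (funext ih)

theorem lift_eq_liftBind (k : ℕ) (t : Term S V) : t.lift k = t.liftBind k var := by
  induction t with
  | var x => rfl
  | app f ts ih => exact congrArg (app (S := S.adjoin k) (some f)) (funext ih)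

theorem bind_lift (k : ℕ) (σ : V → Term (S.adjoin k) W) (t : Term S V) :
    (t.lift k).bind σ = t.liftBind k σ := by
  rw [lift_eq_liftBind, bind_liftBind]
  rfl

theorem mem_vars_app {f : S.Sym} {ts : Fin (S.arity f) → Term S V} {x : V} :
    x ∈ (app f ts).vars ↔ ∃ i, x ∈ (ts i).vars := by
  simp only [vars, Set.mem_iUnion]

theorem bind_congr {σ τ : V → Term S W} {t : Term S V} (h : ∀ x ∈ t.vars, σ x = τ x) :
    t.bind σ = t.bind τ := by
  induction t with
  | var x => exact h x rfl
  | app f ts ih =>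
    simp only [bind]
    congr 1
    funext i
    exact ih i fun x hx => h x (mem_vars_app.2 ⟨i, hx⟩)

theorem liftBind_congr {k : ℕ} {σ τ : V → Term (S.adjoin k) W} {t : Term S V}
    (h : ∀ x ∈ t.vars, σ x = τ x) : t.liftBind k σ = t.liftBind k τ := by
  induction t with
  | var x => exact h x rfl
  | app f ts ih =>
    simp only [liftBind]
    congr 1
    funext i
    exact ih i fun x hx => h x (mem_vars_app.2 ⟨i, hx⟩)

theorem mem_vars_bind {σ : V → Term S W} {t : Term S V} {y : W} :
    y ∈ (t.bind σ).vars ↔ ∃ x ∈ t.vars, y ∈ (σ x).vars := by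
  induction t with
  | var x => simp [bind, vars]
  | app f ts ih =>
    simp only [bind, mem_vars_app, ih]
    exact ⟨fun ⟨i, x, h1, h2⟩ => ⟨x, ⟨i, h1⟩, h2⟩, fun ⟨x, ⟨i, h1⟩, h2⟩ => ⟨i, x, h1, h2⟩⟩

theorem finite_vars (t : Term S V) : t.vars.Finite := by
  induction t with
  | var x => exact Set.finite_singleton x
  | app f ts ih => exact Set.finite_iUnion ih

theorem subtermAt_append {t u : Term S V} {p : List ℕ} (q : List ℕ)
    (h : t.subtermAt p = some u) : t.subtermAt (p ++ q) = u.subtermAt q := by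
  induction p generalizing t with
  | nil =>
    cases t <;> (simp only [subtermAt, Option.some.injEq] at h; subst h; rfl)
  | cons i p ih =>
    cases t with
    | var x => simp [subtermAt] at h
    | app f ts =>
      simp only [subtermAt] at h
      split at h
      · rename_i hi
        simpa only [List.cons_append, subtermAt, hi, dif_pos] using ih h
      · simp at h

theorem subtermAt_nil (t : Term S V) : t.subtermAt [] = some t := by
  cases t <;> rfl

theorem replaceAt_nil (t s : Term S V) : t.replaceAt [] s = s := by
  cases t <;> rfl

theorem subtermAt_replaceAt {t u : Term S V} {p : List ℕ} (s : Term S V)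
    (h : t.subtermAt p = some u) : (t.replaceAt p s).subtermAt p = some s := by
  induction p generalizing t with
  | nil => rw [replaceAt_nil, subtermAt_nil]
  | cons i p ih =>
    cases t with
    | var x => simp [subtermAt] at h
    | app f ts =>
      simp only [subtermAt] at h
      split at h
      · rename_i hi
        simpa only [replaceAt, subtermAt, hi, dif_pos, if_true] using ih h
      · simp at h

theorem replaceAt_append {t u : Term S V} {p : List ℕ} (q : List ℕ) (s : Term S V)
    (h : t.subtermAt p = some u) :
    t.replaceAt (p ++ q) s = t.replaceAt p (u.replaceAt q s) := by
  induction p generalizing t with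
  | nil =>
    cases t <;> (simp only [subtermAt, Option.some.injEq] at h; subst h; rfl)
  | cons i p ih =>
    cases t with
    | var x => simp [subtermAt] at h
    | app f ts =>
      simp only [subtermAt] at h
      split at h
      · rename_i hi
        simp only [List.cons_append, replaceAt]
        congr 1
        funext j
        split
        · rename_i hj
          exact ih (by subst hj; exact h)
        · rfl
      · simp at h

theorem replaceAt_replaceAt {t : Term S V} {p : List ℕ} (s s' : Term S V) :
    (t.replaceAt p s).replaceAt p s' = t.replaceAt p s' := by
  induction p generalizing t with
  | nil => simp only [replaceAt_nil]
  | cons i p ih =>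
    cases t with
    | var x => rfl
    | app f ts =>
      simp only [replaceAt]
      congr 1
      funext j
      split
      · exact ih
      · rfl

theorem subtermAt_bind {σ : V → Term S W} {t u : Term S V} {p : List ℕ}
    (h : t.subtermAt p = some u) : (t.bind σ).subtermAt p = some (u.bind σ) := by
  induction p generalizing t with
  | nil => rw [subtermAt_nil] at h ⊢; rw [Option.some.inj h]
  | cons i p ih =>
    cases t with
    | var x => simp [subtermAt] at h
    | app f ts =>
      simp only [subtermAt] at h
      split at h
      · rename_i hi
        simpa only [bind, subtermAt, hi, dif_pos] using ih h
      · simp at h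

theorem subtermAt_liftBind {k : ℕ} {σ : V → Term (S.adjoin k) W} {t u : Term S V} {p : List ℕ}
    (h : t.subtermAt p = some u) :
    (t.liftBind k σ).subtermAt p = some (u.liftBind k σ) := by
  induction p generalizing t with
  | nil => rw [subtermAt_nil] at h ⊢; rw [Option.some.inj h]
  | cons i p ih =>
    cases t with
    | var x => simp [subtermAt] at h
    | app f ts =>
      simp only [subtermAt] at h
      split at h
      · rename_i hi
        have hi' : i < (S.adjoin k).arity (some f) := hi
        exact (dif_pos hi').trans (ih h)
      · simp at h

theorem replaceAt_bind {σ : V → Term S W} {t u : Term S V} {p : List ℕ} (s : Term S V)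
    (h : t.subtermAt p = some u) :
    (t.replaceAt p s).bind σ = (t.bind σ).replaceAt p (s.bind σ) := by
  induction p generalizing t with
  | nil => simp only [replaceAt_nil]
  | cons i p ih =>
    cases t with
    | var x => simp [subtermAt] at h
    | app f ts =>
      simp only [subtermAt] at h
      split at h
      · simp only [bind, replaceAt]
        congr 1
        funext j
        split
        · rename_i hj
          exact ih (by subst hj; exact h)
        · rfl
      · simp at h

theorem replaceAt_liftBind {k : ℕ} {σ : V → Term (S.adjoin k) W} {t u : Term S V} {p : List ℕ}
    (s : Term S V) (h : t.subtermAt p = some u) :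
    (t.replaceAt p s).liftBind k σ = (t.liftBind k σ).replaceAt p (s.liftBind k σ) := by
  induction p generalizing t with
  | nil => simp only [replaceAt_nil]
  | cons i p ih =>
    cases t with
    | var x => simp [subtermAt] at h
    | app f ts =>
      simp only [subtermAt] at h
      split at h
      · refine congrArg (app (S := S.adjoin k) (some f)) (funext fun j : Fin (S.arity f) => ?_)
        by_cases hj : j.val = i
        · subst hj
          exact (congrArg _ (if_pos rfl)).trans ((ih h).trans (if_pos rfl).symm)
        · exact (congrArg _ (if_neg hj)).trans (if_neg hj).symm
      · simp at h

end Term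

/-! ### Rewriting of terms whose variables may be boxes or names of boxes -/

open Term

variable {S : Signature.{u}} {V : Type v} {W : Type w} {X : Type w'}

/-- The rewrite relation of a TRS over `V` on the terms over any set `W` of variables. -/
inductive RStep (R : TRS S V) : Term S W → Term S W → Prop
  | root {ρ : Rule S V} (hρ : ρ ∈ R) (σ : V → Term S W) :
      RStep R (ρ.lhs.bind σ) (ρ.rhs.bind σ)
  | app (f : S.Sym) (ts : Fin (S.arity f) → Term S W) (i : Fin (S.arity f)) {t : Term S W} :
      RStep R (ts i) t → RStep R (Term.app f ts) (Term.app f (Function.update ts i t))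

theorem replaceAt_app_eq_update (f : S.Sym) (ts : Fin (S.arity f) → Term S W)
    (i : Fin (S.arity f)) (p : List ℕ) (s : Term S W) :
    (Term.app f ts).replaceAt (i.val :: p) s
      = Term.app f (Function.update ts i ((ts i).replaceAt p s)) := by
  simp only [replaceAt]
  congr 1
  funext j
  by_cases hj : j = i
  · subst hj; simp
  · rw [Function.update_of_ne hj, if_neg (fun h => hj (Fin.ext h))]

theorem rstep_replaceAt {R : TRS S V} {ρ : Rule S V} (hρ : ρ ∈ R) {σ : V → Term S W}
    {s : Term S W} {p : List ℕ} (h : s.subtermAt p = some (ρ.lhs.bind σ)) :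
    RStep R s (s.replaceAt p (ρ.rhs.bind σ)) := by
  induction p generalizing s with
  | nil =>
    rw [subtermAt_nil] at h
    rw [replaceAt_nil, Option.some.inj h]
    exact RStep.root hρ σ
  | cons i p ih =>
    cases s with
    | var x => simp [subtermAt] at h
    | app f ts =>
      simp only [subtermAt] at h
      split at h
      · rename_i hi
        rw [replaceAt_app_eq_update f ts ⟨i, hi⟩]
        exact RStep.app f ts ⟨i, hi⟩ (ih h)
      · simp at h

theorem step_iff_rstep {R : TRS S V} {s t : Term S V} : R.Step s t ↔ RStep R s t := by
  constructor
  · rintro ⟨ρ, hρ, p, σ, h1, rfl⟩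
    rw [subst_eq_bind] at h1 ⊢
    exact rstep_replaceAt hρ h1
  · intro h
    induction h with
    | root hρ σ =>
      refine ⟨_, hρ, [], σ, ?_, ?_⟩
      · rw [subtermAt_nil, subst_eq_bind]
      · rw [replaceAt_nil, subst_eq_bind]
    | app f ts i _ ih =>
      obtain ⟨ρ, hρ, p, σ, h1, rfl⟩ := ih
      refine ⟨ρ, hρ, i.val :: p, σ, ?_, ?_⟩
      · simpa only [subtermAt, i.isLt, dif_pos] using h1
      · rw [replaceAt_app_eq_update]

theorem step_eq_rstep (R : TRS S V) : R.Step = RStep (W := V) R := by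
  funext s t
  exact propext step_iff_rstep

theorem bind_update (σ : W → Term S X) (f : S.Sym) (ts : Fin (S.arity f) → Term S W)
    (i : Fin (S.arity f)) (t : Term S W) :
    (Term.app f (Function.update ts i t)).bind σ
      = Term.app f (Function.update (fun j => (ts j).bind σ) i (t.bind σ)) := by
  simp only [Term.bind]
  congr 1
  funext j
  by_cases hj : j = i
  · subst hj; simp
  · simp only [Function.update_of_ne hj]

theorem liftBind_update {k : ℕ} (σ : W → Term (S.adjoin k) X) (f : S.Sym)
    (ts : Fin (S.arity f) → Term S W) (i : Fin (S.arity f)) (t : Term S W) :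
    (Term.app f (Function.update ts i t)).liftBind k σ
      = Term.app (S := S.adjoin k) (some f)
          (Function.update (β := fun _ : Fin ((S.adjoin k).arity (some f)) => Term (S.adjoin k) X)
            (fun j : Fin (S.arity f) => (ts j).liftBind k σ) i (t.liftBind k σ)) := by
  refine congrArg (app (S := S.adjoin k) (some f)) (funext fun j : Fin (S.arity f) => ?_)
  exact (Function.apply_update (fun _ => Term.liftBind k σ) ts i t j)

theorem RStep.bind {R : TRS S V} {s t : Term S W} (h : RStep R s t) (σ : W → Term S X) :
    RStep R (s.bind σ) (t.bind σ) := by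
  induction h with
  | root hρ τ => simp only [bind_bind]; exact RStep.root hρ _
  | app f ts i _ ih =>
    rw [bind_update]
    exact RStep.app f (fun j => (ts j).bind σ) i ih

theorem RStep.liftBind {R : TRS S V} {s t : Term S W} (h : RStep R s t) (k : ℕ)
    (σ : W → Term (S.adjoin k) X) :
    RStep (R.lift k) (s.liftBind k σ) (t.liftBind k σ) := by
  induction h with
  | root hρ τ =>
    simp only [liftBind_bind]
    have := RStep.root (R := R.lift k) (Set.mem_image_of_mem _ hρ)
      (fun x => (τ x).liftBind k σ)
    simpa only [Rule.lift, bind_lift] using this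
  | app f ts i _ ih =>
    rw [liftBind_update]
    exact RStep.app (S := S.adjoin k) (some f) (fun j => (ts j).liftBind k σ) i ih

theorem RStep.vars_subset {R : TRS S V} {s t : Term S W} (h : RStep R s t) :
    t.vars ⊆ s.vars := by
  induction h with
  | root hρ τ =>
    intro y hy
    obtain ⟨x, hx, hxy⟩ := mem_vars_bind.1 hy
    exact mem_vars_bind.2 ⟨x, Rule.vars_subset _ hx, hxy⟩
  | app f ts i _ ih =>
    intro y hy
    obtain ⟨j, hj⟩ := mem_vars_app.1 hy
    by_cases hji : j = i
    · subst hji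
      rw [Function.update_self] at hj
      exact mem_vars_app.2 ⟨j, ih hj⟩
    · rw [Function.update_of_ne hji] at hj
      exact mem_vars_app.2 ⟨j, hj⟩

/-- The rewrite relation in many steps. -/
abbrev RSteps (R : TRS S V) : Term S W → Term S W → Prop := Relation.ReflTransGen (RStep R)

theorem RSteps.bind {R : TRS S V} {s t : Term S W} (h : RSteps R s t) (σ : W → Term S X) :
    RSteps R (s.bind σ) (t.bind σ) :=
  h.lift _ fun _ _ h' => h'.bind σ

theorem RSteps.liftBind {R : TRS S V} {s t : Term S W} (h : RSteps R s t) (k : ℕ)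
    (σ : W → Term (S.adjoin k) X) :
    RSteps (R.lift k) (s.liftBind k σ) (t.liftBind k σ) :=
  h.lift _ fun _ _ h' => h'.liftBind k σ

theorem RSteps.vars_subset {R : TRS S V} {s t : Term S W} (h : RSteps R s t) :
    t.vars ⊆ s.vars := by
  induction h with
  | refl => exact subset_rfl
  | tail _ h ih => exact h.vars_subset.trans ih

theorem RSteps.app_update {R : TRS S V} (f : S.Sym) (ts : Fin (S.arity f) → Term S W)
    (i : Fin (S.arity f)) {t : Term S W} (h : RSteps R (ts i) t) :
    RSteps R (Term.app f ts) (Term.app f (Function.update ts i t)) := by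
  induction h with
  | refl => rw [Function.update_eq_self]
  | @tail b c _ h ih =>
    refine ih.tail ?_
    have := RStep.app f (Function.update ts i b) i (t := c) (by simpa using h)
    simpa only [Function.update_idem] using this

theorem RSteps.app {R : TRS S V} (f : S.Sym) {ts ts' : Fin (S.arity f) → Term S W}
    (h : ∀ i, RSteps R (ts i) (ts' i)) : RSteps R (Term.app f ts) (Term.app f ts') := by
  have key : ∀ s : Finset (Fin (S.arity f)),
      RSteps R (Term.app f ts) (Term.app f fun i => if i ∈ s then ts' i else ts i) := by
    intro s
    induction s using Finset.induction_on with
    | empty => simpa using Relation.ReflTransGen.refl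
    | insert a s ha ih =>
      refine ih.trans ?_
      have := RSteps.app_update (R := R) f (fun i => if i ∈ s then ts' i else ts i) a
        (t := ts' a) (by simpa [ha] using h a)
      convert this using 2
      funext i
      by_cases hi : i = a
      · subst hi; simp
      · simp [hi]
  simpa using key Finset.univ

theorem bind_rsteps_bind {R : TRS S V} {σ τ : W → Term S X} {t : Term S W}
    (h : ∀ x ∈ t.vars, RSteps R (σ x) (τ x)) : RSteps R (t.bind σ) (t.bind τ) := by
  induction t with
  | var x => exact h x rfl
  | app f ts ih =>
    exact RSteps.app f fun i => ih i fun x hx => h x (mem_vars_app.2 ⟨i, hx⟩)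

/-! ### The order on contexts -/

theorem app_none_eq_hole (ts : Fin ((S.adjoin 0).arity none) → Ctx S V) :
    Term.app (S := S.adjoin 0) none ts = hole :=
  congrArg (Term.app (S := S.adjoin 0) none) (funext fun i => i.elim0)

theorem hole_ne_var (x : V) : (hole : Ctx S V) ≠ var x := by
  intro h; cases h

theorem hole_ne_app (f : S.Sym) (Cs : Fin (S.arity f) → Ctx S V) :
    (hole : Ctx S V) ≠ Term.app (S := S.adjoin 0) (some f) Cs := by
  intro h; cases h

namespace Ctx

theorem var_le {x : V} {D : Ctx S V} (h : Ctx.Le (var x) D) : D = var x := by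
  generalize hC : (var x : Ctx S V) = C at h
  induction h with
  | hole_le C => exact absurd hC.symm (hole_ne_var x)
  | refl C => rfl
  | trans _ _ ih1 ih2 =>
    subst hC
    have := ih1 rfl
    exact ih2 this.symm |>.trans this
  | app => cases hC

theorem app_le {f : S.Sym} {Cs : Fin (S.arity f) → Ctx S V} {D : Ctx S V}
    (h : Ctx.Le (Term.app (S := S.adjoin 0) (some f) Cs) D) :
    ∃ Ds : Fin (S.arity f) → Ctx S V,
      D = Term.app (S := S.adjoin 0) (some f) Ds ∧ ∀ i, Ctx.Le (Cs i) (Ds i) := by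
  generalize hC : Term.app (S := S.adjoin 0) (some f) Cs = C at h
  induction h generalizing Cs with
  | hole_le C => exact absurd hC.symm (hole_ne_app f Cs)
  | refl C => exact ⟨Cs, hC.symm, fun i => Ctx.Le.refl _⟩
  | trans _ _ ih1 ih2 =>
    obtain ⟨Ds, rfl, h1⟩ := ih1 hC
    obtain ⟨Es, rfl, h2⟩ := ih2 rfl
    exact ⟨Es, rfl, fun i => (h1 i).trans (h2 i)⟩
  | app g As Bs h _ =>
    cases hC
    exact ⟨Bs, rfl, h⟩

theorem cases_hole (C : Ctx S V) : C = hole ∨ (∃ x, C = var x) ∨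
    ∃ (f : S.Sym) (Cs : Fin (S.arity f) → Ctx S V),
      C = Term.app (S := S.adjoin 0) (some f) Cs := by
  match C with
  | var x => exact Or.inr (Or.inl ⟨x, rfl⟩)
  | .app none ts => exact Or.inl (app_none_eq_hole ts)
  | .app (some f) ts => exact Or.inr (Or.inr ⟨f, ts, rfl⟩)

theorem le_hole {C : Ctx S V} (h : Ctx.Le C hole) : C = hole := by
  obtain rfl | ⟨x, rfl⟩ | ⟨f, Cs, rfl⟩ := cases_hole C
  · rfl
  · exact absurd (var_le h) (hole_ne_var x)
  · obtain ⟨Ds, h1, -⟩ := app_le h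
    exact absurd h1 (hole_ne_app f Ds)

theorem le_var {C : Ctx S V} {x : V} (h : Ctx.Le C (var x)) : C = hole ∨ C = var x := by
  obtain rfl | ⟨y, rfl⟩ | ⟨f, Cs, rfl⟩ := cases_hole C
  · exact Or.inl rfl
  · exact Or.inr (var_le h).symm
  · obtain ⟨Ds, h1, -⟩ := app_le h
    cases h1

theorem le_app {C : Ctx S V} {f : S.Sym} {Ds : Fin (S.arity f) → Ctx S V}
    (h : Ctx.Le C (Term.app (S := S.adjoin 0) (some f) Ds)) :
    C = hole ∨ ∃ Cs : Fin (S.arity f) → Ctx S V,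
      C = Term.app (S := S.adjoin 0) (some f) Cs ∧ ∀ i, Ctx.Le (Cs i) (Ds i) := by
  obtain rfl | ⟨y, rfl⟩ | ⟨g, Cs, rfl⟩ := cases_hole C
  · exact Or.inl rfl
  · cases var_le h
  · obtain ⟨Es, h1, h2⟩ := app_le h
    cases h1
    exact Or.inr ⟨Cs, rfl, h2⟩

theorem app_mono {f : S.Sym} {Cs Ds : Fin (S.arity f) → Ctx S V}
    (h : ∀ i, Ctx.Le (Cs i) (Ds i)) :
    Ctx.Le (Term.app (S := S.adjoin 0) (some f) Cs)
      (Term.app (S := S.adjoin 0) (some f) Ds) :=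
  Ctx.Le.app (some f) Cs Ds h

/-- Induction on contexts, with the hole as a separate case. -/
theorem induction_hole {P : Ctx S V → Prop} (hole : P hole) (var : ∀ x, P (var x))
    (app : ∀ (f : S.Sym) (Cs : Fin (S.arity f) → Ctx S V), (∀ i, P (Cs i)) →
      P (Term.app (S := S.adjoin 0) (some f) Cs)) (C : Ctx S V) : P C := by
  induction C with
  | var x => exact var x
  | app f ts ih =>
    match f, ts, ih with
    | none, ts, _ => rw [app_none_eq_hole]; exact hole
    | some f, ts, ih => exact app f ts ih

theorem le_antisymm {C D : Ctx S V} (h : Ctx.Le C D) (h' : Ctx.Le D C) : C = D := by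
  induction C using induction_hole generalizing D with
  | hole => exact (le_hole h').symm
  | var x => exact (var_le h).symm
  | app f Cs ih =>
    obtain ⟨Ds, rfl, h1⟩ := app_le h
    obtain ⟨Es, h2, h3⟩ := app_le h'
    cases h2
    exact congrArg (Term.app (S := S.adjoin 0) (some f)) (funext fun i => ih i (h1 i) (h3 i))

/-- Below a common bound two contexts never carry clashing symbols, so the supremum is formed
argument by argument. -/
theorem exists_merge {C D T : Ctx S V} (hC : Ctx.Le C T) (hD : Ctx.Le D T) :
    ∃ E, Ctx.IsMerge C D E := by
  induction T using induction_hole generalizing C D with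
  | hole =>
    rw [le_hole hC, le_hole hD]
    exact ⟨hole, Ctx.Le.refl _, Ctx.Le.refl _, fun _ h _ => h⟩
  | var x =>
    obtain rfl | rfl := le_var hC
    · exact ⟨D, Ctx.Le.hole_le _, Ctx.Le.refl _, fun _ _ h => h⟩
    · exact ⟨_, Ctx.Le.refl _, hD, fun _ h _ => h⟩
  | app f Ts ih =>
    obtain rfl | ⟨Cs, rfl, hCs⟩ := le_app hC
    · exact ⟨D, Ctx.Le.hole_le _, Ctx.Le.refl _, fun _ _ h => h⟩
    obtain rfl | ⟨Ds, rfl, hDs⟩ := le_app hD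
    · exact ⟨_, Ctx.Le.refl _, Ctx.Le.hole_le _, fun _ h _ => h⟩
    choose Es hEs using fun i => ih i (hCs i) (hDs i)
    refine ⟨Term.app (S := S.adjoin 0) (some f) Es, app_mono fun i => (hEs i).1,
      app_mono fun i => (hEs i).2.1, fun E' h1 h2 => ?_⟩
    obtain ⟨Es', rfl, h3⟩ := app_le h1
    obtain ⟨Es'', h4, h5⟩ := app_le h2
    cases h4
    exact app_mono fun i => (hEs i).2.2 _ (h3 i) (h5 i)

theorem finite_le (T : Ctx S V) : {C | Ctx.Le C T}.Finite := by
  induction T using induction_hole with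
  | hole => exact (Set.finite_singleton hole).subset fun C hC => le_hole hC
  | var x =>
    exact (Set.toFinite {hole, var x}).subset fun C hC => le_var hC
  | app f Ts ih =>
    refine ((Set.finite_singleton hole).union ((Set.Finite.pi' ih).image
      (Term.app (S := S.adjoin 0) (some f)))).subset fun C hC => ?_
    obtain rfl | ⟨Cs, rfl, h⟩ := le_app hC
    · exact Or.inl rfl
    · exact Or.inr ⟨Cs, h, rfl⟩

theorem le_subtermAt {C D A B : Ctx S V} {p : List ℕ} (h : Ctx.Le C D)
    (hA : C.subtermAt p = some A) (hB : D.subtermAt p = some B) : Ctx.Le A B := by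
  induction p generalizing C D with
  | nil =>
    rw [subtermAt_nil] at hA hB
    rwa [← Option.some.inj hA, ← Option.some.inj hB]
  | cons i p ih =>
    obtain rfl | ⟨x, rfl⟩ | ⟨f, Cs, rfl⟩ := cases_hole C
    · simp [hole, subtermAt, Signature.adjoin] at hA
    · simp [subtermAt] at hA
    · obtain ⟨Ds, rfl, h1⟩ := app_le h
      simp only [subtermAt] at hA hB
      split at hA
      · rename_i hi
        rw [dif_pos hi] at hB
        exact ih (h1 ⟨i, hi⟩) hA hB
      · simp at hA

theorem replaceAt_le {C D A B E : Ctx S V} {p : List ℕ} (h : Ctx.Le C D)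
    (hA : C.subtermAt p = some A) (hB : D.subtermAt p = some B) (hE : Ctx.Le E B) :
    Ctx.Le (C.replaceAt p E) D := by
  induction p generalizing C D with
  | nil =>
    rw [subtermAt_nil] at hB
    rwa [replaceAt_nil, Option.some.inj hB]
  | cons i p ih =>
    obtain rfl | ⟨x, rfl⟩ | ⟨f, Cs, rfl⟩ := cases_hole C
    · simp [hole, subtermAt, Signature.adjoin] at hA
    · simp [subtermAt] at hA
    · obtain ⟨Ds, rfl, h1⟩ := app_le h
      simp only [subtermAt] at hA hB
      split at hA
      · rename_i hi
        rw [dif_pos hi] at hB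
        refine app_mono fun j : Fin (S.arity f) => ?_
        by_cases hj : j.val = i
        · subst hj
          simpa using ih (h1 j) hA hB
        · have hj' : ¬ (j : Fin ((S.adjoin 0).arity (some f))).val = i := hj
          simpa [hj'] using h1 j
      · simp at hA

end Ctx

/-! ### Max-tops -/

/-- This is (L3) at the root. That position must carry a function symbol, hence the separate cases
of a hole and a variable. -/
theorem IsTop.directed {𝕃 : Set (Ctx S V)} (h𝕃 : IsLayerSystem 𝕃) {L N C : Ctx S V}
    (hL : IsTop 𝕃 L C) (hN : IsTop 𝕃 N C) :
    ∃ E, IsTop 𝕃 E C ∧ Ctx.Le L E ∧ Ctx.Le N E := by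
  obtain rfl | ⟨x, rfl⟩ | ⟨f, Cs, rfl⟩ := Ctx.cases_hole L
  · exact ⟨N, hN, Ctx.Le.hole_le _, Ctx.Le.refl _⟩
  · have hC := Ctx.var_le hL.2
    subst hC
    exact ⟨_, hL, Ctx.Le.refl _, hN.2⟩
  · obtain ⟨E, hE⟩ := Ctx.exists_merge hL.2 hN.2
    refine ⟨E, ⟨?_, hE.2.2 _ hL.2 hN.2⟩, hE.1, hE.2.1⟩
    have := h𝕃.merge_mem _ hL.1 N hN.1 [] ⟨f, Cs, subtermAt_nil _⟩ _ (subtermAt_nil _) E hE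
    rwa [replaceAt_nil] at this

/-- The tops of a term have a greatest element. -/
theorem exists_greatest_top {𝕃 : Set (Ctx S V)} (h𝕃 : IsLayerSystem 𝕃) (t : Term S V) :
    ∃ M, IsTop 𝕃 M t.toCtx ∧ ∀ L, IsTop 𝕃 L t.toCtx → Ctx.Le L M := by
  have key : ∀ F : Set (Ctx S V), F.Finite → (∀ L ∈ F, IsTop 𝕃 L t.toCtx) →
      ∃ M, IsTop 𝕃 M t.toCtx ∧ ∀ L ∈ F, Ctx.Le L M := by
    intro F hF
    induction F, hF using Set.Finite.induction_on with
    | empty =>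
      intro _
      obtain ⟨L, hL, -⟩ := h𝕃.exists_top t
      exact ⟨L, hL, by simp⟩
    | @insert a F _ _ ih =>
      intro hF
      obtain ⟨M, hM, h⟩ := ih fun L hL => hF L (Or.inr hL)
      obtain ⟨E, hE, h1, h2⟩ := hM.directed h𝕃 (hF a (Or.inl rfl))
      refine ⟨E, hE, fun L hL => ?_⟩
      obtain rfl | hL := hL
      · exact h2
      · exact (h L hL).trans h1
  obtain ⟨M, hM, h⟩ := key {L | IsTop 𝕃 L t.toCtx}
    ((Ctx.finite_le t.toCtx).subset fun L hL => hL.2) fun L hL => hL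
  exact ⟨M, hM, h⟩

theorem isMaxTop_of_greatest {𝕃 : Set (Ctx S V)} {M C : Ctx S V} (hM : IsTop 𝕃 M C)
    (h : ∀ L, IsTop 𝕃 L C → Ctx.Le L M) : IsMaxTop 𝕃 M C :=
  ⟨hM, fun L hL hML => Ctx.le_antisymm (h L hL) hML⟩

theorem IsMaxTop.greatest {𝕃 : Set (Ctx S V)} (h𝕃 : IsLayerSystem 𝕃) {M C : Ctx S V}
    (hM : IsMaxTop 𝕃 M C) {L : Ctx S V} (hL : IsTop 𝕃 L C) : Ctx.Le L M := by
  obtain ⟨E, hE, h1, h2⟩ := hM.1.directed h𝕃 hL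
  rwa [hM.2 E hE h1] at h2

theorem IsMaxTop.unique {𝕃 : Set (Ctx S V)} (h𝕃 : IsLayerSystem 𝕃) {M M' C : Ctx S V}
    (hM : IsMaxTop 𝕃 M C) (hM' : IsMaxTop 𝕃 M' C) : M = M' :=
  Ctx.le_antisymm (hM'.greatest h𝕃 hM.1) (hM.greatest h𝕃 hM'.1)

theorem IsMaxTop.ne_hole {𝕃 : Set (Ctx S V)} (h𝕃 : IsLayerSystem 𝕃) {M : Ctx S V}
    {t : Term S V} (hM : IsMaxTop 𝕃 M t.toCtx) : M ≠ hole := by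
  rintro rfl
  obtain ⟨L, hL, hne⟩ := h𝕃.exists_top t
  exact hne (hM.2 L hL (Ctx.Le.hole_le _))

/-! ### Exchange of variables and holes -/

/-- Two contexts are equal up to replacing variables and holes by variables and holes. -/
inductive SameShape : Ctx S V → Ctx S V → Prop
  | hole_hole : SameShape hole hole
  | hole_var (y : V) : SameShape hole (var y)
  | var_hole (x : V) : SameShape (var x) hole
  | var_var (x y : V) : SameShape (var x) (var y)
  | app (f : S.Sym) (Cs Ds : Fin (S.arity f) → Ctx S V) : (∀ i, SameShape (Cs i) (Ds i)) →
      SameShape (Term.app (S := S.adjoin 0) (some f) Cs)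
        (Term.app (S := S.adjoin 0) (some f) Ds)

/-- (L2) changes one position at a time. The surrounding context `B` makes the induction go through:
the arguments of a function symbol are exchanged one after the other, the rest being part of the
surroundings. -/
theorem SameShape.replaceAt_mem {𝕃 : Set (Ctx S V)} (h𝕃 : IsLayerSystem 𝕃) {C D : Ctx S V}
    (h : SameShape C D) (B : Ctx S V) (p : List ℕ) (hp : B.IsPos p)
    (hB : B.replaceAt p C ∈ 𝕃) : B.replaceAt p D ∈ 𝕃 := by
  induction h generalizing B p with
  | hole_hole => exact hB
  | hole_var y => exact (h𝕃.var_iff_hole y B p hp).2 hB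
  | var_hole x => exact (h𝕃.var_iff_hole x B p hp).1 hB
  | var_var x y => exact (h𝕃.var_iff_hole y B p hp).2 ((h𝕃.var_iff_hole x B p hp).1 hB)
  | app f Cs Ds h ih =>
    obtain ⟨u, hu⟩ := Option.isSome_iff_exists.1 hp
    have key : ∀ F : Finset (Fin (S.arity f)), B.replaceAt p
        (Term.app (S := S.adjoin 0) (some f) fun i : Fin (S.arity f) => if i ∈ F then Ds i else Cs i) ∈ 𝕃 := by
      intro F
      induction F using Finset.induction_on with
      | empty => simpa using hB
      | insert a F ha ihF =>
        let Es : Fin (S.arity f) → Ctx S V := fun i => if i ∈ F then Ds i else Cs i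
        have hsub : (B.replaceAt p (Term.app (S := S.adjoin 0) (some f) Es)).subtermAt p
            = some (Term.app (S := S.adjoin 0) (some f) Es) := subtermAt_replaceAt _ hu
        have hrep : ∀ Z : Ctx S V,
            (B.replaceAt p (Term.app (S := S.adjoin 0) (some f) Es)).replaceAt (p ++ [a.val]) Z
              = B.replaceAt p
                  (Term.app (S := S.adjoin 0) (some f) (Function.update Es a Z)) := by
          intro Z
          rw [replaceAt_append _ _ hsub, replaceAt_replaceAt]
          have := replaceAt_app_eq_update (S := S.adjoin 0) (some f) Es a [] Z
          rw [replaceAt_nil] at this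
          exact congrArg _ this
        have hsub2 : (Term.app (S := S.adjoin 0) (some f) Es).subtermAt [a.val]
            = some (Cs a) := by
          have ha' : a.val < (S.adjoin 0).arity (some f) := a.isLt
          refine (dif_pos ha').trans ?_
          rw [subtermAt_nil]
          exact congrArg some (if_neg ha)
        have := ih a (B.replaceAt p (Term.app (S := S.adjoin 0) (some f) Es)) (p ++ [a.val])
          (by rw [Term.IsPos, subtermAt_append _ hsub, hsub2]; rfl)
          (by
            rw [hrep]
            have h1 : Function.update Es a (Cs a) = Es := by
              rw [Function.update_eq_self_iff]
              exact (if_neg ha).symm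
            exact (congrArg (fun E : Fin (S.arity f) → Ctx S V => B.replaceAt p
              (Term.app (S := S.adjoin 0) (some f) E) ∈ 𝕃) h1).mpr ihF)
        rw [hrep] at this
        have h2 : Function.update Es a (Ds a)
            = fun i : Fin (S.arity f) => if i ∈ insert a F then Ds i else Cs i := by
          funext i
          by_cases hi : i = a
          · subst hi; simp
          · simp [hi, Es]
        exact h2 ▸ this
    simpa using key Finset.univ

theorem SameShape.mem {𝕃 : Set (Ctx S V)} (h𝕃 : IsLayerSystem 𝕃) {C D : Ctx S V}
    (h : SameShape C D) (hC : C ∈ 𝕃) : D ∈ 𝕃 := by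
  have := h.replaceAt_mem h𝕃 C [] (by rw [Term.IsPos, subtermAt_nil]; rfl)
    (by rwa [replaceAt_nil])
  rwa [replaceAt_nil] at this

/-! ### Decompositions of terms -/

/-- A term some of whose subterms are put into boxes. The box with content `u` is the
variable `Sum.inr u`. -/
abbrev Deco (S : Signature.{u}) (V : Type v) := Term S (V ⊕ Term S V)

namespace Deco

/-- The term obtained by opening all boxes. -/
def flat (D : Deco S V) : Term S V := D.bind (Sum.elim var id)

/-- The context obtained by replacing all boxes by holes. -/
def ctx (D : Deco S V) : Ctx S V := D.liftBind 0 (Sum.elim var fun _ => hole)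

/-- A term without boxes. -/
def embed (u : Term S V) : Deco S V := u.bind fun x => var (Sum.inl x)

@[simp] theorem flat_inl (x : V) : flat (var (Sum.inl x) : Deco S V) = var x := rfl

@[simp] theorem flat_inr (u : Term S V) : flat (var (Sum.inr u) : Deco S V) = u := rfl

@[simp] theorem flat_app (f : S.Sym) (Ds : Fin (S.arity f) → Deco S V) :
    flat (Term.app f Ds) = Term.app f fun i => flat (Ds i) := rfl

@[simp] theorem ctx_inl (x : V) : ctx (var (Sum.inl x) : Deco S V) = var x := rfl

@[simp] theorem ctx_inr (u : Term S V) : ctx (var (Sum.inr u) : Deco S V) = hole := rfl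

@[simp] theorem ctx_app (f : S.Sym) (Ds : Fin (S.arity f) → Deco S V) :
    ctx (Term.app f Ds) = Term.app (S := S.adjoin 0) (some f) fun i : Fin (S.arity f) =>
      ctx (Ds i) := rfl

theorem flat_embed (u : Term S V) : flat (embed u) = u := by
  rw [flat, embed, bind_bind]
  exact bind_var u

theorem inr_notMem_vars_embed (u w : Term S V) : Sum.inr w ∉ (embed u).vars := by
  intro h
  obtain ⟨x, -, hx⟩ := mem_vars_bind.1 h
  cases hx

theorem ctx_le (D : Deco S V) : Ctx.Le D.ctx D.flat.toCtx := by
  induction D with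
  | var x =>
    cases x with
    | inl x => exact Ctx.Le.refl _
    | inr u => exact Ctx.Le.hole_le _
  | app f Ds ih => exact Ctx.app_mono ih

theorem exists_of_le {M : Ctx S V} {t : Term S V} (h : Ctx.Le M t.toCtx) :
    ∃ D : Deco S V, D.ctx = M ∧ D.flat = t := by
  induction t generalizing M with
  | var x =>
    obtain rfl | rfl := Ctx.le_var h
    · exact ⟨var (Sum.inr (var x)), rfl, rfl⟩
    · exact ⟨var (Sum.inl x), rfl, rfl⟩
  | app f ts ih =>
    obtain rfl | ⟨Cs, rfl, h'⟩ := Ctx.le_app h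
    · exact ⟨var (Sum.inr (Term.app f ts)), rfl, rfl⟩
    · choose Ds h1 h2 using fun i => ih i (h' i)
      refine ⟨Term.app f Ds, ?_, ?_⟩
      · exact congrArg (Term.app (S := S.adjoin 0) (some f)) (funext h1)
      · exact congrArg (Term.app f) (funext h2)

/-- `E` is obtained from `D` by partially opening boxes. -/
inductive Refine : Deco S V → Deco S V → Prop
  | inl (x : V) : Refine (var (Sum.inl x)) (var (Sum.inl x))
  | inr (E : Deco S V) : Refine (var (Sum.inr E.flat)) E
  | app (f : S.Sym) (Ds Es : Fin (S.arity f) → Deco S V) : (∀ i, Refine (Ds i) (Es i)) →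
      Refine (Term.app f Ds) (Term.app f Es)

theorem refine_of_ctx_le {D E : Deco S V} (h : Ctx.Le D.ctx E.ctx) (hf : D.flat = E.flat) :
    Refine D E := by
  induction D generalizing E with
  | var x =>
    cases x with
    | inl x =>
      have h1 := Ctx.var_le h
      match E with
      | var (Sum.inl y) =>
        cases h1
        exact Refine.inl _
      | var (Sum.inr u) => exact absurd h1 (hole_ne_var x)
      | .app f Es => cases h1
    | inr u =>
      have : u = E.flat := hf
      subst this
      exact Refine.inr E
  | app f Ds ih =>
    obtain ⟨Cs, h1, h2⟩ := Ctx.app_le h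
    match E with
    | var (Sum.inl y) => cases h1
    | var (Sum.inr u) => exact absurd h1 (hole_ne_app f Cs)
    | .app g Es =>
      cases h1
      refine Refine.app f Ds Es fun i => ih i (h2 i) ?_
      simp only [flat_app, Term.app.injEq, heq_eq_eq, true_and] at hf
      exact congrFun hf i

theorem Refine.antisymm_of_ctx_eq {D E : Deco S V} (h : Refine D E) (h' : D.ctx = E.ctx) :
    D = E := by
  induction h with
  | inl x => rfl
  | inr E =>
    match E with
    | var (Sum.inl x) => exact absurd h' (hole_ne_var x)
    | var (Sum.inr u) => rfl
    | .app f Es => exact absurd h' (hole_ne_app f _)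
  | app f Ds Es _ ih =>
    have h1 := eq_of_heq (Term.app.inj h').2
    exact congrArg _ (funext fun i => ih i (congrFun h1 i))

theorem ext_ctx_flat {D E : Deco S V} (h : D.ctx = E.ctx) (hf : D.flat = E.flat) : D = E :=
  (refine_of_ctx_le (h ▸ Ctx.Le.refl _) hf).antisymm_of_ctx_eq h

/-- `D` is the decomposition of `t` into its max-top and its aliens. -/
def IsMax (𝕃 : Set (Ctx S V)) (D : Deco S V) (t : Term S V) : Prop :=
  IsMaxTop 𝕃 D.ctx t.toCtx ∧ D.flat = t

theorem exists_isMax {𝕃 : Set (Ctx S V)} (h𝕃 : IsLayerSystem 𝕃) (t : Term S V) :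
    ∃ D, IsMax 𝕃 D t := by
  obtain ⟨M, hM, h⟩ := exists_greatest_top h𝕃 t
  obtain ⟨D, rfl, h2⟩ := exists_of_le hM.2
  exact ⟨D, isMaxTop_of_greatest hM h, h2⟩

theorem IsMax.unique {𝕃 : Set (Ctx S V)} (h𝕃 : IsLayerSystem 𝕃) {D E : Deco S V}
    {t : Term S V} (hD : IsMax 𝕃 D t) (hE : IsMax 𝕃 E t) : D = E :=
  ext_ctx_flat (hD.1.unique h𝕃 hE.1) (hD.2.trans hE.2.symm)

theorem exists_subtermAt_of_mem_vars {U : Type*} {t : Term S U} {x : U} (h : x ∈ t.vars) :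
    ∃ p, t.subtermAt p = some (var x) := by
  induction t with
  | var y =>
    obtain rfl : x = y := h
    exact ⟨[], rfl⟩
  | app f ts ih =>
    obtain ⟨i, hi⟩ := mem_vars_app.1 h
    obtain ⟨p, hp⟩ := ih i hi
    exact ⟨i.val :: p, by simpa only [subtermAt, i.isLt, dif_pos] using hp⟩

theorem IsMax.isAlien {𝕃 : Set (Ctx S V)} (h𝕃 : IsLayerSystem 𝕃) {D : Deco S V}
    {t u : Term S V} (hD : IsMax 𝕃 D t) (hu : Sum.inr u ∈ D.vars) : IsAlien 𝕃 u t := by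
  obtain ⟨p, hp⟩ := exists_subtermAt_of_mem_vars hu
  refine ⟨D.ctx, p, hD.1, hD.1.ne_hole h𝕃, subtermAt_liftBind hp, ?_⟩
  rw [← hD.2]
  exact subtermAt_bind hp

theorem mem_vars_of_ctx_subtermAt {D : Deco S V} {p : List ℕ} {u : Term S V}
    (h : D.ctx.subtermAt p = some hole) (hu : D.flat.subtermAt p = some u) :
    Sum.inr u ∈ D.vars := by
  induction D generalizing p with
  | var x =>
    cases x with
    | inl x =>
      cases p with
      | nil =>
        rw [subtermAt_nil] at h
        exact absurd (Option.some.inj h).symm (hole_ne_var x)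
      | cons i p => simp [subtermAt] at h
    | inr w =>
      cases p with
      | nil =>
        rw [subtermAt_nil] at hu
        rw [← Option.some.inj hu]
        rfl
      | cons i p => simp [subtermAt, hole, Signature.adjoin] at h
  | app f Ds ih =>
    cases p with
    | nil =>
      rw [subtermAt_nil] at h
      exact absurd (Option.some.inj h).symm (hole_ne_app f _)
    | cons i p =>
      simp only [ctx_app, flat_app, subtermAt] at h hu
      split at hu
      · rename_i hi
        replace h := (dif_pos (show i < (S.adjoin 0).arity (some f) from hi)).symm.trans h
        exact mem_vars_app.2 ⟨⟨i, hi⟩, ih _ h hu⟩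
      · simp at hu

theorem IsMax.mem_vars {𝕃 : Set (Ctx S V)} (h𝕃 : IsLayerSystem 𝕃) {D : Deco S V}
    {t u : Term S V} (hD : IsMax 𝕃 D t) (hu : IsAlien 𝕃 u t) : Sum.inr u ∈ D.vars := by
  obtain ⟨M, p, hM, -, h1, h2⟩ := hu
  rw [hM.unique h𝕃 hD.1] at h1
  rw [← hD.2] at h2
  exact mem_vars_of_ctx_subtermAt h1 h2

end Deco

/-! ### The rank -/

/-- Bounds the ranks of aliens, so that the supremum in `rank` is not the default value `0` of an
unbounded set. -/
theorem rank_le_size (𝕃 : Set (Ctx S V)) (t : Term S V) : rank 𝕃 t ≤ t.size := by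
  induction hn : t.size using Nat.strong_induction_on generalizing t with
  | _ n ih =>
    subst hn
    rw [rank]
    have h1 : sSup {k | ∃ u, ∃ _h : IsAlien 𝕃 u t, k = rank 𝕃 u} ≤ t.size - 1 := by
      refine csSup_le' ?_
      rintro k ⟨u, hu, rfl⟩
      have := ih u.size hu.size_lt u rfl
      have := hu.size_lt
      omega
    have := t.size_pos
    omega

theorem IsAlien.rank_lt {𝕃 : Set (Ctx S V)} {u t : Term S V} (h : IsAlien 𝕃 u t) :
    rank 𝕃 u < rank 𝕃 t := by
  rw [rank.eq_1 𝕃 t]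
  have : rank 𝕃 u ≤ sSup {k | ∃ u, ∃ _h : IsAlien 𝕃 u t, k = rank 𝕃 u} := by
    refine le_csSup ⟨t.size, ?_⟩ ⟨u, h, rfl⟩
    rintro k ⟨w, hw, rfl⟩
    exact (rank_le_size 𝕃 w).trans hw.size_lt.le
  omega

theorem rank_le_succ {𝕃 : Set (Ctx S V)} {t : Term S V} {k : ℕ}
    (h : ∀ u, IsAlien 𝕃 u t → rank 𝕃 u ≤ k) : rank 𝕃 t ≤ k + 1 := by
  rw [rank]
  have : sSup {k | ∃ u, ∃ _h : IsAlien 𝕃 u t, k = rank 𝕃 u} ≤ k := by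
    refine csSup_le' ?_
    rintro _ ⟨u, hu, rfl⟩
    exact h u hu
  omega

theorem one_le_rank (𝕃 : Set (Ctx S V)) (t : Term S V) : 1 ≤ rank 𝕃 t := by
  rw [rank]
  omega

/-! ### Maximal decompositions and bounds on the rank -/

namespace Deco

/-- Every subterm `F` of `E` that is rooted by a function symbol has a context above all tops of
the term obtained from `F`. -/
def Full (𝕃 : Set (Ctx S V)) : Deco S V → Prop
  | var _ => True
  | .app f Es => (∀ N, IsTop 𝕃 N (flat (Term.app f Es)).toCtx → Ctx.Le N (ctx (Term.app f Es)))
      ∧ ∀ i, Full 𝕃 (Es i)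

/-- A top of the subterm at `p` can be merged into the max-top at `p` by (L3). The result is again a
top of `t`, so by maximality it adds nothing. -/
theorem IsMax.full_subterm {𝕃 : Set (Ctx S V)} (h𝕃 : IsLayerSystem 𝕃) {D : Deco S V}
    {t : Term S V} (hD : IsMax 𝕃 D t) (E : Deco S V) (p : List ℕ)
    (hp : D.subtermAt p = some E) : E.Full 𝕃 := by
  induction E generalizing p with
  | var x => trivial
  | app f Es ih =>
    refine ⟨fun N hN => ?_, fun i => ih i (p ++ [i.val]) ?_⟩
    · have hc : D.ctx.subtermAt p = some (ctx (Term.app f Es)) := subtermAt_liftBind hp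
      have ht : t.toCtx.subtermAt p = some (flat (Term.app f Es)).toCtx := by
        rw [← hD.2, toCtx, toCtx, lift_eq_liftBind, lift_eq_liftBind]
        exact subtermAt_liftBind (subtermAt_bind hp)
      obtain ⟨E, hE⟩ := Ctx.exists_merge (ctx_le (Term.app f Es)) hN.2
      have h1 := h𝕃.merge_mem _ hD.1.1.1 N hN.1 p ⟨f, _, hc⟩ _ hc E hE
      have h2 : Ctx.Le (D.ctx.replaceAt p E) t.toCtx :=
        Ctx.replaceAt_le hD.1.1.2 hc ht (hE.2.2 _ (ctx_le _) hN.2)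
      have h3 := hD.1.greatest h𝕃 ⟨h1, h2⟩
      exact hE.2.1.trans (Ctx.le_subtermAt h3 (subtermAt_replaceAt E hc) hc)
    · rw [subtermAt_append _ hp]
      simp only [subtermAt, i.isLt, dif_pos, subtermAt_nil]

theorem IsMax.full {𝕃 : Set (Ctx S V)} (h𝕃 : IsLayerSystem 𝕃) {D : Deco S V}
    {t : Term S V} (hD : IsMax 𝕃 D t) : D.Full 𝕃 :=
  hD.full_subterm h𝕃 D [] (subtermAt_nil D)

/-- `F` is what `E` puts in place of the box of `D` that contains the box `u`. -/
theorem Refine.exists_box {𝕃 : Set (Ctx S V)} {D E : Deco S V} (h : Refine D E)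
    (hE : E.Full 𝕃) {u : Term S V} (hu : Sum.inr u ∈ E.vars) :
    ∃ F : Deco S V, F.Full 𝕃 ∧ Sum.inr F.flat ∈ D.vars ∧ Sum.inr u ∈ F.vars := by
  induction h with
  | inl x => cases hu
  | inr E => exact ⟨E, hE, rfl, hu⟩
  | app f Ds Es _ ih =>
    obtain ⟨i, hi⟩ := mem_vars_app.1 hu
    obtain ⟨F, h1, h2, h3⟩ := ih i (hE.2 i) hi
    exact ⟨F, h1, mem_vars_app.2 ⟨i, h2⟩, h3⟩

/-- Fullness places the max-top of the underlying term below the context of `E`. Every box of `E`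
therefore lies inside an alien of that term, where induction on the size applies. -/
theorem Full.rank_lt {𝕃 : Set (Ctx S V)} (h𝕃 : IsLayerSystem 𝕃) {E : Deco S V}
    (hE : E.Full 𝕃) {u : Term S V} (hu : Sum.inr u ∈ E.vars) :
    E = var (Sum.inr u) ∨ rank 𝕃 u < rank 𝕃 E.flat := by
  induction hn : E.flat.size using Nat.strong_induction_on generalizing E u with
  | _ n ih =>
    subst hn
    match E with
    | var x =>
      obtain rfl : Sum.inr u = x := hu
      exact Or.inl rfl
    | .app f Es =>
      obtain ⟨N, hN⟩ := exists_isMax h𝕃 (flat (Term.app f Es))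
      obtain ⟨F, h1, h2, h3⟩ := (refine_of_ctx_le (hE.1 _ hN.1.1) hN.2).exists_box hE hu
      have ha := hN.isAlien h𝕃 h2
      right
      obtain rfl | h := ih _ ha.size_lt h1 h3 rfl
      · exact ha.rank_lt
      · exact h.trans ha.rank_lt

variable {𝕃 : Set (Ctx S V)}

/-- A decomposition of `t` whose context is a layer is refined by the maximal decomposition. -/
theorem IsMax.refine (h𝕃 : IsLayerSystem 𝕃) {D E : Deco S V} {t : Term S V}
    (hE : IsMax 𝕃 E t) (hD : D.ctx ∈ 𝕃) (hf : D.flat = t) : Refine D E :=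
  refine_of_ctx_le (hE.1.greatest h𝕃 ⟨hD, hf ▸ ctx_le D⟩) (hf.trans hE.2.symm)

theorem IsMax.rank_le (h𝕃 : IsLayerSystem 𝕃) {D E : Deco S V} {t : Term S V}
    (hE : IsMax 𝕃 E t) (hD : D.ctx ∈ 𝕃) (hf : D.flat = t) {k : ℕ}
    (hk : ∀ w, Sum.inr w ∈ D.vars → rank 𝕃 w ≤ k) {u : Term S V} (hu : Sum.inr u ∈ E.vars) :
    rank 𝕃 u ≤ k := by
  obtain ⟨F, h1, h2, h3⟩ := (hE.refine h𝕃 hD hf).exists_box (hE.full h𝕃) hu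
  obtain rfl | h := h1.rank_lt h𝕃 h3
  · exact hk _ h2
  · exact h.le.trans (hk _ h2)

/-- Any layer decomposition bounds the rank, maximal or not: the aliens lie inside its boxes, and by
`Full.rank_lt` this does not raise their rank. -/
theorem rank_flat_le (h𝕃 : IsLayerSystem 𝕃) {D : Deco S V} (hD : D.ctx ∈ 𝕃) {k : ℕ}
    (hk : ∀ w, Sum.inr w ∈ D.vars → rank 𝕃 w ≤ k) : rank 𝕃 D.flat ≤ k + 1 := by
  obtain ⟨E, hE⟩ := exists_isMax h𝕃 D.flat
  exact rank_le_succ fun u hu => hE.rank_le h𝕃 hD rfl hk (hE.mem_vars h𝕃 hu)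

/-- Replacement of each variable of the context by a variable or a box, and of each box by a
variable or a box. -/
theorem bind_ctx_mem (h𝕃 : IsLayerSystem 𝕃) {D : Deco S V} (hD : D.ctx ∈ 𝕃)
    (h : V ⊕ Term S V → V ⊕ Term S V) : (ctx (D.bind fun x => var (h x))) ∈ 𝕃 := by
  refine SameShape.mem h𝕃 ?_ hD
  clear hD
  induction D with
  | var x =>
    simp only [Term.bind]
    rcases x with x | u
    · rcases h (Sum.inl x) with y | w
      · exact SameShape.var_var _ _
      · exact SameShape.var_hole _
    · rcases h (Sum.inr u) with y | w
      · exact SameShape.hole_var _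
      · exact SameShape.hole_hole
  | app f Ds ih => exact SameShape.app f _ _ ih

/-- By (L2) the renamed max-top is still a layer, and the aliens are handled by induction. Since `f`
may identify variables, only an inequality is claimed. -/
theorem rank_rename_le (h𝕃 : IsLayerSystem 𝕃) (f : V → V) (t : Term S V) :
    rank 𝕃 (t.bind fun x => var (f x)) ≤ rank 𝕃 t := by
  induction hn : t.size using Nat.strong_induction_on generalizing t with
  | _ n ih =>
    subst hn
    obtain ⟨D, hD⟩ := exists_isMax h𝕃 t
    have h1 := bind_ctx_mem h𝕃 hD.1.1.1 (Sum.map f fun u => u.bind fun x => var (f x))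
    have h2 := rank_flat_le h𝕃 h1 (k := rank 𝕃 t - 1) ?_
    · have h3 := one_le_rank 𝕃 t
      rw [Nat.sub_add_cancel h3] at h2
      convert h2 using 2
      rw [← hD.2, flat, flat, bind_bind, bind_bind]
      congr 1
      funext x
      cases x <;> rfl
    · intro w hw
      obtain ⟨x, hx, hxw⟩ := mem_vars_bind.1 hw
      rcases x with x | u
      · cases hxw
      · cases hxw
        have ha := hD.isAlien h𝕃 hx
        have := ih _ ha.size_lt u rfl
        have := ha.rank_lt
        show rank 𝕃 (u.bind fun x => var (f x)) ≤ _
        omega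

end Deco

namespace Deco

/-! ### Rewriting decompositions -/

/-- A rewrite step inside a box. -/
inductive BoxStep (R : TRS S V) : Deco S V → Deco S V → Prop
  | inr {u u' : Term S V} : RStep R u u' → BoxStep R (var (Sum.inr u)) (var (Sum.inr u'))
  | app (f : S.Sym) (Ds : Fin (S.arity f) → Deco S V) (i : Fin (S.arity f)) {D : Deco S V} :
      BoxStep R (Ds i) D → BoxStep R (Term.app f Ds) (Term.app f (Function.update Ds i D))

theorem BoxStep.ctx_eq {R : TRS S V} {D D' : Deco S V} (h : BoxStep R D D') :
    D'.ctx = D.ctx := by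
  induction h with
  | inr h => rfl
  | app f Ds i _ ih =>
    refine (liftBind_update _ f Ds i _).trans ?_
    refine congrArg (Term.app (S := S.adjoin 0) (some f)) ?_
    exact Function.update_eq_self_iff.2 ih

theorem BoxStep.mem_vars {R : TRS S V} {D D' : Deco S V} (h : BoxStep R D D') {w : Term S V}
    (hw : Sum.inr w ∈ D'.vars) :
    Sum.inr w ∈ D.vars ∨ ∃ u, Sum.inr u ∈ D.vars ∧ RStep R u w := by
  induction h with
  | inr h =>
    cases hw
    exact Or.inr ⟨_, rfl, h⟩
  | app f Ds i _ ih =>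
    obtain ⟨j, hj⟩ := mem_vars_app.1 hw
    by_cases hji : j = i
    · subst hji
      rw [Function.update_self] at hj
      obtain h | ⟨u, h1, h2⟩ := ih hj
      · exact Or.inl (mem_vars_app.2 ⟨j, h⟩)
      · exact Or.inr ⟨u, mem_vars_app.2 ⟨j, h1⟩, h2⟩
    · rw [Function.update_of_ne hji] at hj
      exact Or.inl (mem_vars_app.2 ⟨j, hj⟩)

/-- The path `p` either ends at a function symbol of `D` or enters a box; it cannot end at an
unboxed variable, as no left-hand side is a variable. -/
theorem app_or_boxStep {R : TRS S V} {ρ : Rule S V} (hρ : ρ ∈ R) {σ : V → Term S V}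
    {D : Deco S V} {p : List ℕ} (h : D.flat.subtermAt p = some (ρ.lhs.bind σ)) :
    (∃ f Ds, D.subtermAt p = some (Term.app f Ds)) ∨
      ∃ D', BoxStep R D D' ∧ D'.flat = D.flat.replaceAt p (ρ.rhs.bind σ) := by
  induction p generalizing D with
  | nil =>
    match D with
    | var (Sum.inl x) =>
      rw [subtermAt_nil] at h
      have h := Option.some.inj h
      rcases hl : ρ.lhs with y | ⟨f, ts⟩
      · exact absurd hl (ρ.lhs_ne_var y)
      · rw [hl] at h
        cases h
    | var (Sum.inr u) =>
      refine Or.inr ⟨var (Sum.inr _), BoxStep.inr (rstep_replaceAt hρ h), rfl⟩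
    | .app f Ds => exact Or.inl ⟨f, Ds, rfl⟩
  | cons i p ih =>
    match D with
    | var (Sum.inl x) => simp [subtermAt] at h
    | var (Sum.inr u) =>
      refine Or.inr ⟨var (Sum.inr _), BoxStep.inr (rstep_replaceAt hρ h), rfl⟩
    | .app f Ds =>
      simp only [flat_app, subtermAt] at h
      split at h
      · rename_i hi
        obtain ⟨g, Es, h1⟩ | ⟨D', h1, h2⟩ := ih h
        · exact Or.inl ⟨g, Es, by simpa only [subtermAt, hi, dif_pos] using h1⟩
        · refine Or.inr ⟨_, BoxStep.app f Ds ⟨i, hi⟩ h1, ?_⟩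
          refine (bind_update _ f Ds ⟨i, hi⟩ D').trans ?_
          exact (congrArg _ (congrArg _ h2)).trans
            (replaceAt_app_eq_update f (fun j => flat (Ds j)) ⟨i, hi⟩ p _).symm
      · simp at h

open Classical in
/-- The decomposition with a given context and a given underlying term, if it exists. -/
noncomputable def ofCtxFlat (C : Ctx S V) (t : Term S V) : Deco S V :=
  if h : ∃ E : Deco S V, E.ctx = C ∧ E.flat = t then h.choose else var (Sum.inr t)

theorem ofCtxFlat_eq (E : Deco S V) : ofCtxFlat E.ctx E.flat = E := by
  have h : ∃ E' : Deco S V, E'.ctx = E.ctx ∧ E'.flat = E.flat := ⟨E, rfl, rfl⟩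
  rw [ofCtxFlat, dif_pos h]
  exact ext_ctx_flat h.choose_spec.1 h.choose_spec.2

theorem eq_bind_of_match {τ : V → Ctx S V} {σ : V → Term S V} {l : Term S V} {E : Deco S V}
    (h1 : E.ctx = l.liftBind 0 τ) (h2 : E.flat = l.bind σ) :
    E = l.bind (fun x => ofCtxFlat (τ x) (σ x)) ∧
      ∀ x ∈ l.vars, (ofCtxFlat (τ x) (σ x)).ctx = τ x ∧ (ofCtxFlat (τ x) (σ x)).flat = σ x := by
  induction l generalizing E with
  | var x =>
    have h1' : E.ctx = τ x := h1
    have h2' : E.flat = σ x := h2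
    have h3 : ofCtxFlat (τ x) (σ x) = E := by rw [← h1', ← h2', ofCtxFlat_eq]
    refine ⟨h3.symm, ?_⟩
    rintro y rfl
    rw [h3]
    exact ⟨h1', h2'⟩
  | app f ls ih =>
    match E with
    | var (Sum.inl x) => cases h1
    | var (Sum.inr u) => exact absurd h1 (hole_ne_app f _)
    | .app g Es =>
      have hg : g = f := (Term.app.inj h2).1
      subst hg
      have e1 := congrFun (eq_of_heq (Term.app.inj h1).2)
      have e2 := congrFun (eq_of_heq (Term.app.inj h2).2)
      refine ⟨congrArg (Term.app g) (funext fun i => (ih i (e1 i) (e2 i)).1), fun x hx => ?_⟩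
      obtain ⟨i, hi⟩ := mem_vars_app.1 hx
      exact (ih i (e1 i) (e2 i)).2 x hi

variable {R : TRS S V} {𝕃 : Set (Ctx S V)}

/-- A rewrite step from `t` is a step of the maximal decomposition of `t` or a step inside one of
its boxes. -/
theorem IsMax.step (hW : WeaklyLayered R 𝕃) {D : Deco S V} {s t : Term S V}
    (hD : IsMax 𝕃 D s) (h : RStep R s t) :
    ∃ D' : Deco S V, D'.ctx ∈ 𝕃 ∧ D'.flat = t ∧ (RStep R D D' ∨ BoxStep R D D') := by
  obtain ⟨ρ, hρ, p, hst⟩ := step_iff_rstep.2 h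
  have hst' := hst
  obtain ⟨σ, h1, h2⟩ := hst'
  rw [subst_eq_bind] at h1 h2
  obtain ⟨hM, rfl⟩ := hD
  obtain ⟨f, Ds, h3⟩ | ⟨D', h3, h4⟩ := app_or_boxStep hρ h1
  · have hc : D.ctx.subtermAt p = some (ctx (Term.app f Ds)) := subtermAt_liftBind h3
    have hf : D.flat.subtermAt p = some (flat (Term.app f Ds)) := subtermAt_bind h3
    -- The layer `L` given by (W) will be the context of the new decomposition.
    obtain ⟨L, hL, τ, h4, h5⟩ := hW ρ hρ _ _ _ p hM ⟨f, _, hc⟩ hst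
    simp only [Rule.lift, subst_eq_bind, bind_lift] at h4 h5
    rw [hc] at h4
    rw [hf] at h1
    obtain ⟨h6, h7⟩ := eq_bind_of_match (Option.some.inj h4) (Option.some.inj h1)
    rw [h6] at h3
    refine ⟨D.replaceAt p (ρ.rhs.bind fun x => ofCtxFlat (τ x) (σ x)), ?_, ?_,
      Or.inl (rstep_replaceAt hρ h3)⟩
    · rw [ctx, replaceAt_liftBind _ h3, liftBind_bind]
      rw [h5, ← liftBind_congr fun x hx => (h7 x (ρ.vars_subset hx)).1] at hL
      exact hL
    · rw [flat, replaceAt_bind _ h3, bind_bind, h2]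
      congr 1
      exact bind_congr fun x hx => (h7 x (ρ.vars_subset hx)).2
  · exact ⟨D', h3.ctx_eq ▸ hM.1.1, h4.trans h2.symm, Or.inr h3⟩

end Deco

/-- After the step there is a decomposition whose context is a layer and whose boxes contain old
aliens or one-step reducts of them; the latter are covered by induction on the size. -/
theorem RStep.rank_le {R : TRS S V} {𝕃 : Set (Ctx S V)} (h𝕃 : IsLayerSystem 𝕃)
    (hW : WeaklyLayered R 𝕃) {s t : Term S V} (h : RStep R s t) : rank 𝕃 t ≤ rank 𝕃 s := by
  induction hn : s.size using Nat.strong_induction_on generalizing s t with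
  | _ n ih =>
    subst hn
    obtain ⟨D, hD⟩ := Deco.exists_isMax h𝕃 s
    obtain ⟨D', h1, rfl, h3⟩ := hD.step hW h
    have h4 := Deco.rank_flat_le h𝕃 h1 (k := rank 𝕃 s - 1) ?_
    · rwa [Nat.sub_add_cancel (one_le_rank 𝕃 s)] at h4
    · intro w hw
      have key : ∃ u, Sum.inr u ∈ D.vars ∧ rank 𝕃 w ≤ rank 𝕃 u := by
        obtain h3 | h3 := h3
        · exact ⟨w, h3.vars_subset hw, le_rfl⟩
        · obtain h4 | ⟨u, h4, h5⟩ := h3.mem_vars hw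
          · exact ⟨w, h4, le_rfl⟩
          · exact ⟨u, h4, ih _ (hD.isAlien h𝕃 h4).size_lt h5 rfl⟩
      obtain ⟨u, h4, h5⟩ := key
      have := (hD.isAlien h𝕃 h4).rank_lt
      omega

theorem RSteps.rank_le {R : TRS S V} {𝕃 : Set (Ctx S V)} (h𝕃 : IsLayerSystem 𝕃)
    (hW : WeaklyLayered R 𝕃) {s t : Term S V} (h : RSteps R s t) : rank 𝕃 t ≤ rank 𝕃 s := by
  induction h with
  | refl => exact le_rfl
  | tail _ h ih => exact (h.rank_le h𝕃 hW).trans ih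

namespace Deco

/-! ### Opening boxes -/

variable {R : TRS S V} {𝕃 : Set (Ctx S V)}

/-- The decomposition obtained by opening all boxes whose content does not have rank `r`. -/
noncomputable def shorten (𝕃 : Set (Ctx S V)) (r : ℕ) (D : Deco S V) : Deco S V :=
  D.bind (Sum.elim (fun x => var (Sum.inl x))
    fun u => if rank 𝕃 u = r then var (Sum.inr u) else embed u)

theorem shorten_inr (r : ℕ) (u : Term S V) : shorten 𝕃 r (var (Sum.inr u))
    = if rank 𝕃 u = r then var (Sum.inr u) else embed u := rfl

theorem flat_shorten (r : ℕ) (D : Deco S V) : (D.shorten 𝕃 r).flat = D.flat := by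
  rw [flat, shorten, bind_bind, flat]
  congr 1
  funext x
  rcases x with x | u
  · rfl
  · simp only [Sum.elim_inr]
    split
    · rfl
    · exact flat_embed u

theorem mem_vars_shorten {r : ℕ} {D : Deco S V} {u : Term S V}
    (h : Sum.inr u ∈ (D.shorten 𝕃 r).vars) : Sum.inr u ∈ D.vars ∧ rank 𝕃 u = r := by
  obtain ⟨x, hx, hxu⟩ := mem_vars_bind.1 h
  rcases x with x | w
  · cases hxu
  · simp only [Sum.elim_inr] at hxu
    split at hxu
    · rename_i hr
      cases hxu
      exact ⟨hx, hr⟩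
    · exact absurd hxu (inr_notMem_vars_embed w u)

theorem shorten_eq_embed {r : ℕ} {D : Deco S V}
    (h : ∀ u, Sum.inr u ∈ D.vars → rank 𝕃 u ≠ r) : D.shorten 𝕃 r = embed D.flat := by
  rw [embed, flat, bind_bind, shorten]
  refine bind_congr fun x hx => ?_
  rcases x with x | u
  · rfl
  · simp only [Sum.elim_inr, if_neg (h u hx)]
    rfl

/-- `E` is obtained from `D` by opening some boxes. -/
inductive Unbox : Deco S V → Deco S V → Prop
  | var (x : V ⊕ Term S V) : Unbox (var x) (var x)
  | open_box (u : Term S V) : Unbox (Term.var (Sum.inr u)) (embed u)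
  | app (f : S.Sym) (Ds Es : Fin (S.arity f) → Deco S V) : (∀ i, Unbox (Ds i) (Es i)) →
      Unbox (Term.app f Ds) (Term.app f Es)

theorem Unbox.refl (D : Deco S V) : Unbox D D := by
  induction D with
  | var x => exact Unbox.var x
  | app f Ds ih => exact Unbox.app f Ds Ds ih

theorem Unbox.eq_of_embed {u : Term S V} {E : Deco S V} (h : Unbox (embed u) E) :
    E = embed u := by
  induction u generalizing E with
  | var x => cases h; rfl
  | app f ts ih =>
    cases h with
    | app _ _ Es h => exact congrArg (Term.app f) (funext fun i => ih i (h i))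

theorem Unbox.trans {D E F : Deco S V} (h : Unbox D E) (h' : Unbox E F) : Unbox D F := by
  induction h generalizing F with
  | var x => exact h'
  | open_box u =>
    rw [h'.eq_of_embed]
    exact Unbox.open_box u
  | app f Ds Es _ ih =>
    cases h' with
    | app _ _ Fs h => exact Unbox.app f Ds Fs fun i => ih i (h i)

theorem unbox_ite (u : Term S V) (p : Prop) [Decidable p] :
    Unbox (Term.var (Sum.inr u)) (if p then Term.var (Sum.inr u) else embed u) := by
  split
  · exact Unbox.refl _
  · exact Unbox.open_box u

/-- If `E` cuts into a box of `D`, the boxes it leaves there have rank below that of the content,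
hence below `r`, and shortening opens them all. So partial openings become complete ones. -/
theorem Refine.unbox_shorten (h𝕃 : IsLayerSystem 𝕃) {D E : Deco S V} (h : Refine D E)
    (hE : E.Full 𝕃) {r : ℕ} (hr : ∀ u, Sum.inr u ∈ D.vars → rank 𝕃 u ≤ r) :
    Unbox (D.shorten 𝕃 r) (E.shorten 𝕃 r) := by
  induction h with
  | inl x => exact Unbox.refl _
  | inr E =>
    have key : E.shorten 𝕃 r = embed E.flat ∨ ∃ u, E = Term.var (Sum.inr u) := by
      match E with
      | Term.var (Sum.inl x) => exact Or.inl rfl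
      | Term.var (Sum.inr u) => exact Or.inr ⟨u, rfl⟩
      | .app f Es =>
        refine Or.inl (shorten_eq_embed fun u hu => ?_)
        obtain h | h := hE.rank_lt h𝕃 hu
        · cases h
        · exact (h.trans_le (hr _ rfl)).ne
    obtain h | ⟨u, rfl⟩ := key
    · rw [h, shorten_inr]
      split
      · exact Unbox.open_box _
      · exact Unbox.refl _
    · exact Unbox.refl _
  | app f Ds Es _ ih =>
    exact Unbox.app f _ _ fun i => ih i (hE.2 i) fun u hu => hr u (mem_vars_app.2 ⟨i, hu⟩)

/-- The term in which each box is marked by the symbol `◊`. -/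
def mark (D : Deco S V) : Term (S.adjoin 1) V :=
  D.liftBind 1 (Sum.elim Term.var fun u => diamond (u.lift 1))

theorem mark_embed (u : Term S V) : mark (embed u) = u.lift 1 := by
  rw [mark, embed, liftBind_bind, lift_eq_liftBind]
  rfl

/-- Opening a box always changes the marked term, since no term lifted from `S` has `◊` at its root.
This yields the strict decrease in the inner induction. -/
theorem Unbox.eq_of_mark_eq {D E : Deco S V} (h : Unbox D E) (h' : D.mark = E.mark) :
    D = E := by
  induction h with
  | var x => rfl
  | open_box u =>
    rw [mark_embed] at h'
    cases u with
    | var x => cases h'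
    | app f ts => cases h'
  | app f Ds Es _ ih =>
    have h1 := eq_of_heq (Term.app.inj h').2
    exact congrArg _ (funext fun i => ih i (congrFun h1 i))

theorem Unbox.mark_rsteps [Nonempty V] {D E : Deco S V} (h : Unbox D E) :
    RSteps (diamondTRS (S := S) (V := V)) D.mark E.mark := by
  induction h with
  | var x => exact Relation.ReflTransGen.refl
  | open_box u =>
    obtain ⟨x⟩ := ‹Nonempty V›
    refine Relation.ReflTransGen.single ?_
    rw [mark_embed]
    exact RStep.root (R := diamondTRS) ⟨x, rfl⟩ fun _ => u.lift 1
  | app f Ds Es _ ih => exact RSteps.app (S := S.adjoin 1) (some f) ih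

/-- The term over the set `Q` of names of boxes, for a naming `q` of the contents of boxes. -/
def cls {Q : Type w} (q : Term S V → Q) (D : Deco S V) : Term S (V ⊕ Q) :=
  D.bind fun x => Term.var (Sum.map id q x)

/-- `A` simulates a reduction from `D` to a term, up to the naming `q` of boxes. -/
structure Simulates (R : TRS S V) (𝕃 : Set (Ctx S V)) (r : ℕ) {Q : Type w} (q : Term S V → Q)
    (D A : Deco S V) : Prop where
  cls_rsteps : RSteps R (D.cls q) (A.cls q)
  mark_rsteps : RSteps (R.lift 1) D.mark A.mark
  rank_le : ∀ u, Sum.inr u ∈ A.vars → rank 𝕃 u ≤ r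

theorem Simulates.refl {r : ℕ} {Q : Type w} {q : Term S V → Q} {D : Deco S V}
    (h : ∀ u, Sum.inr u ∈ D.vars → rank 𝕃 u ≤ r) : Simulates R 𝕃 r q D D :=
  ⟨Relation.ReflTransGen.refl, Relation.ReflTransGen.refl, h⟩

theorem Simulates.trans {r : ℕ} {Q : Type w} {q : Term S V → Q} {D A B : Deco S V}
    (h : Simulates R 𝕃 r q D A) (h' : Simulates R 𝕃 r q A B) : Simulates R 𝕃 r q D B :=
  ⟨h.1.trans h'.1, h.2.trans h'.2, h'.3⟩

theorem simulates_of_rstep {r : ℕ} {Q : Type w} {q : Term S V → Q} {D A : Deco S V}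
    (h : RStep R D A) (hr : ∀ u, Sum.inr u ∈ D.vars → rank 𝕃 u ≤ r) :
    Simulates R 𝕃 r q D A :=
  ⟨.single (h.bind _), .single (h.liftBind 1 _), fun u hu => hr u (h.vars_subset hu)⟩

/-- A box of rank `r` stays closed in `A` while its content is rewritten, and its name is unchanged
by `hq`; it is opened afterwards if the rank has dropped. A box of smaller rank was already open, so
the step is an ordinary one. -/
theorem BoxStep.exists_simulates (h𝕃 : IsLayerSystem 𝕃) (hW : WeaklyLayered R 𝕃) {r : ℕ}
    {Q : Type w} {q : Term S V → Q}
    (hq : ∀ u u', rank 𝕃 u ≤ r → RStep R u u' → q u = q u') {D D' : Deco S V}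
    (h : BoxStep R D D') (hr : ∀ u, Sum.inr u ∈ D.vars → rank 𝕃 u ≤ r) :
    ∃ A, A.flat = D'.flat ∧ Simulates R 𝕃 r q (D.shorten 𝕃 r) A ∧
      Unbox A (D'.shorten 𝕃 r) := by
  induction h with
  | @inr u u' h =>
    have hu := hr u rfl
    have hle := h.rank_le h𝕃 hW
    rw [shorten_inr, shorten_inr]
    by_cases hur : rank 𝕃 u = r
    · refine ⟨Term.var (Sum.inr u'), rfl, ⟨?_, ?_, ?_⟩, unbox_ite u' _⟩
      · rw [if_pos hur]
        have : cls q (Term.var (Sum.inr u)) = cls q (Term.var (Sum.inr u')) :=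
          congrArg (fun x => Term.var (Sum.inr x)) (hq u u' hu h)
        rw [this]
      · rw [if_pos hur]
        refine RSteps.app (S := S.adjoin 1) none fun _ => .single ?_
        rw [lift_eq_liftBind, lift_eq_liftBind]
        exact h.liftBind 1 _
      · intro w hw
        cases hw
        exact hle.trans hu
    · rw [if_neg hur, if_neg (by omega)]
      exact ⟨embed u', flat_embed u', simulates_of_rstep (h.bind _)
        fun w hw => absurd hw (inr_notMem_vars_embed u w), Unbox.refl _⟩
  | @app f Ds i D' h ih =>
    obtain ⟨A, h1, h2, h3⟩ := ih fun u hu => hr u (mem_vars_app.2 ⟨i, hu⟩)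
    refine ⟨Term.app f (Function.update (fun j => (Ds j).shorten 𝕃 r) i A), ?_, ⟨?_, ?_, ?_⟩, ?_⟩
    · rw [flat, flat, bind_update, bind_update]
      change Term.app f (Function.update (fun j => flat ((Ds j).shorten 𝕃 r)) i A.flat) = _
      simp only [flat_shorten, h1]
      rfl
    · rw [cls, cls, bind_update]
      exact RSteps.app_update f (fun j => cls q ((Ds j).shorten 𝕃 r)) i h2.1
    · rw [mark, mark, liftBind_update]
      exact RSteps.app_update (S := S.adjoin 1) (some f)
        (fun j : Fin (S.arity f) => mark ((Ds j).shorten 𝕃 r)) i h2.2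
    · intro u hu
      obtain ⟨j, hj⟩ := mem_vars_app.1 hu
      by_cases hji : j = i
      · subst hji
        rw [Function.update_self] at hj
        exact h2.3 u hj
      · rw [Function.update_of_ne hji] at hj
        exact hr u (mem_vars_app.2 ⟨j, (mem_vars_shorten hj).1⟩)
    · rw [shorten, bind_update]
      refine Unbox.app f _ _ fun j => ?_
      by_cases hji : j = i
      · subst hji
        rw [Function.update_self, Function.update_self]
        exact h3
      · simp only [Function.update_of_ne hji]
        exact Unbox.refl _

/-- A rewrite step is simulated on shortened maximal decompositions, up to opening boxes. -/
theorem IsMax.exists_simulates (h𝕃 : IsLayerSystem 𝕃) (hW : WeaklyLayered R 𝕃) {r : ℕ}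
    {Q : Type w} {q : Term S V → Q}
    (hq : ∀ u u', rank 𝕃 u ≤ r → RStep R u u' → q u = q u') {D E : Deco S V} {s t : Term S V}
    (hD : IsMax 𝕃 D s) (hE : IsMax 𝕃 E t) (hs : rank 𝕃 s ≤ r + 1) (h : RStep R s t) :
    ∃ A, A.flat = t ∧ Simulates R 𝕃 r q (D.shorten 𝕃 r) A ∧ Unbox A (E.shorten 𝕃 r) := by
  have hr : ∀ u, Sum.inr u ∈ D.vars → rank 𝕃 u ≤ r := fun u hu => by
    have := (hD.isAlien h𝕃 hu).rank_lt
    omega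
  obtain ⟨D', h1, h2, h3 | h3⟩ := hD.step hW h
  · refine ⟨D'.shorten 𝕃 r, (flat_shorten r D').trans h2, simulates_of_rstep (h3.bind _)
      fun u hu => (mem_vars_shorten hu).2.le, (hE.refine h𝕃 h1 h2).unbox_shorten h𝕃
      (hE.full h𝕃) fun u hu => hr u (h3.vars_subset hu)⟩
  · obtain ⟨A, h4, h5, h6⟩ := h3.exists_simulates h𝕃 hW hq hr
    refine ⟨A, h4.trans h2, h5, h6.trans ((hE.refine h𝕃 h1 h2).unbox_shorten h𝕃
      (hE.full h𝕃) fun u hu => ?_)⟩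
    obtain h7 | ⟨w, h7, h8⟩ := h3.mem_vars hu
    · exact hr u h7
    · exact (h8.rank_le h𝕃 hW).trans (hr w h7)

end Deco

/-! ### Confluence -/

/-- All pairs of reducts of `s` are joinable. -/
def ConfluentAt (R : TRS S V) (s : Term S W) : Prop :=
  ∀ b c, RSteps R s b → RSteps R s c → Relation.Join (RSteps R) b c

theorem ConfluentAt.of_rsteps {R : TRS S V} {s t : Term S W} (h : ConfluentAt R s)
    (hst : RSteps R s t) : ConfluentAt R t :=
  fun b c hb hc => h b c (hst.trans hb) (hst.trans hc)

/-- Confluence at a term over an arbitrary set of variables follows from confluence at its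
renamings to terms over the infinite set `V`. -/
theorem confluentAt_of_rename [Infinite V] [Nonempty X] {R : TRS S V} {D : Term S X}
    (h : ∀ f : X → V, ConfluentAt R (D.bind fun x => var (f x))) : ConfluentAt R D := by
  classical
  have : Finite D.vars := D.finite_vars
  obtain ⟨n, ⟨e⟩⟩ := Finite.exists_equiv_fin D.vars
  -- The value outside `D.vars` is irrelevant, since `f` is inverted only on `D.vars`.
  let f : X → V := fun x =>
    if hx : x ∈ D.vars then Infinite.natEmbedding V (e ⟨x, hx⟩) else Infinite.natEmbedding V 0
  have hf : Set.InjOn f D.vars := by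
    intro x hx y hy hxy
    simp only [f, dif_pos hx, dif_pos hy, EmbeddingLike.apply_eq_iff_eq, Fin.val_inj] at hxy
    simpa using hxy
  let g : V → X := Function.invFunOn f D.vars
  have hback : ∀ t : Term S X, t.vars ⊆ D.vars →
      (t.bind fun x => var (f x)).bind (fun y => var (g y)) = t := by
    intro t ht
    rw [bind_bind]
    refine (bind_congr fun x hx => ?_).trans (bind_var t)
    exact congrArg var (hf.leftInvOn_invFunOn (ht hx))
  intro b c hb hc
  obtain ⟨d, h1, h2⟩ := h f _ _ (hb.bind _) (hc.bind _)
  have h3 := RSteps.bind h1 fun y => var (g y)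
  have h4 := RSteps.bind h2 fun y => var (g y)
  rw [hback _ hb.vars_subset] at h3
  rw [hback _ hc.vars_subset] at h4
  exact ⟨_, h3, h4⟩

/-- Joinability of terms of rank at most `r`. -/
def joinSetoid {R : TRS S V} {𝕃 : Set (Ctx S V)} {r : ℕ}
    (hr : ∀ s, rank 𝕃 s ≤ r → ConfluentAt R s) : Setoid (Term S V) where
  -- The disjunct `u = v` gives reflexivity at terms of rank above `r`; transitivity needs
  -- confluence at the middle term.
  r u v := u = v ∨ (rank 𝕃 u ≤ r ∧ rank 𝕃 v ≤ r ∧ Relation.Join (RSteps R) u v)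
  iseqv := by
    refine ⟨fun u => Or.inl rfl, ?_, ?_⟩
    · rintro u v (rfl | ⟨h1, h2, a, h3, h4⟩)
      · exact Or.inl rfl
      · exact Or.inr ⟨h2, h1, a, h4, h3⟩
    · rintro u v w (rfl | ⟨h1, h2, a, h3, h4⟩)
      · exact id
      · rintro (rfl | ⟨-, h5, b, h6, h7⟩)
        · exact Or.inr ⟨h1, h2, a, h3, h4⟩
        · obtain ⟨c, h8, h9⟩ := hr v h2 a b h4 h6
          exact Or.inr ⟨h1, h5, c, h3.trans h8, h7.trans h9⟩

theorem exists_common_reduct {R : TRS S V} {u : Term S W} (hu : ConfluentAt R u)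
    {F : Set (Term S W)} (hF : F.Finite) (h : ∀ v ∈ F, Relation.Join (RSteps R) u v) :
    ∃ w, RSteps R u w ∧ ∀ v ∈ F, RSteps R v w := by
  induction F, hF using Set.Finite.induction_on with
  | empty => exact ⟨u, Relation.ReflTransGen.refl, by simp⟩
  | @insert a F _ _ ih =>
    obtain ⟨w, h1, h2⟩ := ih fun v hv => h v (Or.inr hv)
    obtain ⟨c, h3, h4⟩ := h a (Or.inl rfl)
    obtain ⟨d, h5, h6⟩ := hu w c h1 h3
    refine ⟨d, h1.trans h5, fun v hv => ?_⟩
    obtain rfl | hv := hv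
    · exact h4.trans h6
    · exact (h2 v hv).trans h5

/-- Finitely many pairwise joinable terms that are confluent have a common reduct; `g` chooses one
for each class. It turns names of boxes back into terms. -/
theorem exists_section {R : TRS S V} {𝕃 : Set (Ctx S V)} {r : ℕ}
    (hr : ∀ s, rank 𝕃 s ≤ r → ConfluentAt R s) {F : Set (Term S V)} (hF : F.Finite)
    (hFr : ∀ u ∈ F, rank 𝕃 u ≤ r) :
    ∃ g : Quotient (joinSetoid hr) → Term S V,
      ∀ u ∈ F, RSteps R u (g (Quotient.mk _ u)) := by
  have key : ∀ c : Quotient (joinSetoid hr),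
      ∃ w, ∀ u ∈ F, Quotient.mk _ u = c → RSteps R u w := by
    intro c
    by_cases hc : ∃ u ∈ F, Quotient.mk (joinSetoid hr) u = c
    · obtain ⟨u, hu, rfl⟩ := hc
      obtain ⟨w, -, h⟩ := exists_common_reduct (hr u (hFr u hu))
        (hF.subset (Set.sep_subset F fun v =>
          Quotient.mk (joinSetoid hr) v = Quotient.mk (joinSetoid hr) u)) (fun v hv => by
          obtain rfl | ⟨-, -, a, h1, h2⟩ := Quotient.exact hv.2
          · exact ⟨v, Relation.ReflTransGen.refl, Relation.ReflTransGen.refl⟩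
          · exact ⟨a, h2, h1⟩)
      exact ⟨w, fun v hv hvu => h v ⟨hv, hvu⟩⟩
    -- No term of `F` lies in this class, so any value does.
    · exact ⟨c.out, fun u hu huc => absurd ⟨u, hu, huc⟩ hc⟩
  choose g hg using key
  exact ⟨g, fun u hu => hg _ u hu rfl⟩

/-! ### Confluence at the next rank -/

namespace Deco

variable {R : TRS S V} {𝕃 : Set (Ctx S V)}

/-- The holes of the aliens of rank `r` become variables, which (L2) permits. The aliens that remain
have rank at most `r - 1`, even after renaming. -/
theorem IsMax.rank_shorten_rename_le (h𝕃 : IsLayerSystem 𝕃) {r : ℕ} (hr : 1 ≤ r)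
    {D : Deco S V} {s : Term S V} (hD : IsMax 𝕃 D s) (hs : rank 𝕃 s ≤ r + 1)
    (h : V ⊕ Term S V → V) :
    rank 𝕃 ((D.shorten 𝕃 r).bind fun x => Term.var (h x)) ≤ r := by
  classical
  have h1 := bind_ctx_mem h𝕃 hD.1.1.1 (Sum.elim (fun x => Sum.inl (h (Sum.inl x))) fun u =>
    if rank 𝕃 u = r then Sum.inl (h (Sum.inr u))
      else Sum.inr (u.bind fun x => Term.var (h (Sum.inl x))))
  have h2 := rank_flat_le h𝕃 h1 (k := r - 1) ?_
  · rw [Nat.sub_add_cancel hr] at h2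
    convert h2 using 2
    rw [flat, shorten, bind_bind, bind_bind]
    congr 1
    funext x
    rcases x with x | u
    · rfl
    · simp only [Sum.elim_inr]
      split
      · rfl
      · rw [embed, bind_bind]
        rfl
  · intro w hw
    obtain ⟨x, hx, hxw⟩ := mem_vars_bind.1 hw
    rcases x with x | u
    · cases hxw
    · simp only [Sum.elim_inr] at hxw
      split at hxw
      · cases hxw
      · cases hxw
        have := (hD.isAlien h𝕃 hx).rank_lt
        have : rank 𝕃 (u.bind fun x => Term.var (h (Sum.inl x))) ≤ rank 𝕃 u :=
          rank_rename_le h𝕃 (fun x => h (Sum.inl x)) u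
        omega

theorem finite_boxes (D : Deco S V) : {u | Sum.inr u ∈ D.vars}.Finite :=
  Set.Finite.preimage Sum.inr_injective.injOn D.finite_vars

theorem flat_rsteps_cls_bind {Q : Type w} {q : Term S V → Q} {g : Q → Term S V} {A : Deco S V}
    (h : ∀ u, Sum.inr u ∈ A.vars → RSteps R u (g (q u))) :
    RSteps R A.flat ((A.cls q).bind (Sum.elim Term.var g)) := by
  rw [flat, cls, bind_bind]
  refine bind_rsteps_bind fun x hx => ?_
  rcases x with x | u
  · exact Relation.ReflTransGen.refl
  · exact h u hx

theorem transGen_relStep {R T : TRS S V} {a b c : Term S V}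
    (h : RSteps R a b) (h' : Relation.TransGen (RStep T) b c) :
    Relation.TransGen (RelStep T R) a c := by
  induction h' with
  | single h' =>
    refine .single ⟨_, ?_, _, step_iff_rstep.2 h', Relation.ReflTransGen.refl⟩
    rwa [step_eq_rstep]
  | tail _ h' ih =>
    exact ih.tail ⟨_, Relation.ReflTransGen.refl, _, step_iff_rstep.2 h',
      Relation.ReflTransGen.refl⟩

/-- A reduction is simulated on the shortened maximal decomposition of its first term until a box
has to be opened. -/
theorem IsMax.exists_simulates_rsteps [Nonempty V] (h𝕃 : IsLayerSystem 𝕃)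
    (hW : WeaklyLayered R 𝕃) {r : ℕ} {Q : Type w} {q : Term S V → Q}
    (hq : ∀ u u', rank 𝕃 u ≤ r → RStep R u u' → q u = q u') {D : Deco S V} {s t : Term S V}
    (hD : IsMax 𝕃 D s) (hs : rank 𝕃 s ≤ r + 1) (h : RSteps R s t) :
    ∃ A, Simulates R 𝕃 r q (D.shorten 𝕃 r) A ∧ RSteps R A.flat t ∧
      ((∃ E, IsMax 𝕃 E t ∧ A = E.shorten 𝕃 r) ∨
        (rank 𝕃 A.flat ≤ r + 1 ∧ ∀ E, IsMax 𝕃 E A.flat → Relation.TransGen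
          (RelStep diamondTRS (R.lift 1)) (D.shorten 𝕃 r).mark (E.shorten 𝕃 r).mark)) := by
  induction h with
  | refl =>
    refine ⟨D.shorten 𝕃 r, Simulates.refl fun u hu => (mem_vars_shorten hu).2.le, ?_,
      Or.inl ⟨D, hD, rfl⟩⟩
    rw [flat_shorten, hD.2]
  | @tail t' t h1 h2 ih =>
    obtain ⟨A, h3, h4, ⟨E, hE, rfl⟩ | h5⟩ := ih
    · obtain ⟨F, hF⟩ := exists_isMax h𝕃 t
      have ht' : rank 𝕃 t' ≤ r + 1 := (RSteps.rank_le h𝕃 hW h1).trans hs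
      obtain ⟨B, rfl, h6, h7⟩ := hE.exists_simulates h𝕃 hW hq hF ht' h2
      refine ⟨B, h3.trans h6, Relation.ReflTransGen.refl, ?_⟩
      -- If these differ, this step forces a box open, and the marked term strictly decreases.
      by_cases hB : B = F.shorten 𝕃 r
      · exact Or.inl ⟨F, hF, hB⟩
      · refine Or.inr ⟨(h2.rank_le h𝕃 hW).trans ht', fun F' hF' => ?_⟩
        rw [hF'.unique h𝕃 hF]
        obtain h8 | h8 := Relation.reflTransGen_iff_eq_or_transGen.1 h7.mark_rsteps
        · exact absurd (h7.eq_of_mark_eq h8.symm) hB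
        · exact transGen_relStep (h3.trans h6).mark_rsteps h8
    -- After the first opening the simulation is frozen at `A`; only the reduction from `A.flat` is
    -- prolonged.
    · exact ⟨A, h3, h4.tail h2, Or.inr h5⟩

theorem confluentAt_succ [Infinite V] (h𝕃 : IsLayerSystem 𝕃) (hW : WeaklyLayered R 𝕃)
    (hB : BoundedDuplicating R) {r : ℕ} (hr1 : 1 ≤ r)
    (hr : ∀ s, rank 𝕃 s ≤ r → ConfluentAt R s) (m : Term (S.adjoin 1) V) (s : Term S V)
    (D : Deco S V) (hD : IsMax 𝕃 D s) (hs : rank 𝕃 s ≤ r + 1)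
    (hm : (D.shorten 𝕃 r).mark = m) : ConfluentAt R s := by
  induction m using hB.induction generalizing s D with
  | _ m ih =>
    subst hm
    let q : Term S V → Quotient (joinSetoid hr) := Quotient.mk _
    have hq : ∀ u u', rank 𝕃 u ≤ r → RStep R u u' → q u = q u' := fun u u' hu h =>
      Quotient.sound (Or.inr ⟨hu, (h.rank_le h𝕃 hW).trans hu, u', .single h, .refl⟩)
    intro t₁ t₂ ht₁ ht₂
    obtain ⟨A₁, s₁, f₁, c₁⟩ := hD.exists_simulates_rsteps h𝕃 hW hq hs ht₁
    obtain ⟨A₂, s₂, f₂, c₂⟩ := hD.exists_simulates_rsteps h𝕃 hW hq hs ht₂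
    -- The names of boxes are not elements of `V`, so the outer induction hypothesis is applied to
    -- renamings into `V`.
    have hconf : ConfluentAt R ((D.shorten 𝕃 r).cls q) := by
      refine confluentAt_of_rename fun f => hr _ ?_
      rw [cls, bind_bind]
      exact hD.rank_shorten_rename_le h𝕃 hr1 hs fun x => f (Sum.map id q x)
    obtain ⟨C, hC₁, hC₂⟩ := hconf _ _ s₁.cls_rsteps s₂.cls_rsteps
    obtain ⟨g, hg⟩ := exists_section hr (A₁.finite_boxes.union A₂.finite_boxes) (by
      rintro u (hu | hu)
      · exact s₁.rank_le u hu
      · exact s₂.rank_le u hu)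
    have g₁ := (flat_rsteps_cls_bind fun u hu => hg u (Or.inl hu)).trans
      (RSteps.bind hC₁ (Sum.elim var g))
    have g₂ := (flat_rsteps_cls_bind fun u hu => hg u (Or.inr hu)).trans
      (RSteps.bind hC₂ (Sum.elim var g))
    set c := C.bind (Sum.elim var g)
    -- In the interrupted case the inner induction makes `A.flat` confluent. Confluence at `c` is
    -- recorded too: it joins the two valleys when both reductions were interrupted.
    have key : ∀ {A : Deco S V} {t : Term S V}, RSteps R A.flat t → RSteps R A.flat c →
        ((∃ E, IsMax 𝕃 E t ∧ A = E.shorten 𝕃 r) ∨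
        (rank 𝕃 A.flat ≤ r + 1 ∧ ∀ E, IsMax 𝕃 E A.flat → Relation.TransGen
          (RelStep diamondTRS (R.lift 1)) (D.shorten 𝕃 r).mark (E.shorten 𝕃 r).mark)) →
        RSteps R t c ∨ (Relation.Join (RSteps R) t c ∧ ConfluentAt R c) := by
      rintro A t hAt hAc (⟨E, hE, rfl⟩ | ⟨h1, h2⟩)
      · rw [flat_shorten, hE.2] at hAc
        exact Or.inl hAc
      · obtain ⟨E, hE⟩ := exists_isMax h𝕃 A.flat
        have h3 := ih _ (h2 E hE) A.flat E hE h1 rfl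
        exact Or.inr ⟨h3 _ _ hAt hAc, h3.of_rsteps hAc⟩
    obtain k₁ | ⟨⟨w₁, k₁, l₁⟩, hc⟩ := key f₁ g₁ c₁
    · obtain k₂ | ⟨⟨w₂, k₂, l₂⟩, -⟩ := key f₂ g₂ c₂
      · exact ⟨c, k₁, k₂⟩
      · exact ⟨w₂, k₁.trans l₂, k₂⟩
    · obtain k₂ | ⟨⟨w₂, k₂, l₂⟩, -⟩ := key f₂ g₂ c₂
      · exact ⟨w₁, k₁, k₂.trans l₁⟩
      · obtain ⟨d, h1, h2⟩ := hc w₁ w₂ l₁ l₂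
        exact ⟨d, k₁.trans h1, k₂.trans h2⟩

end Deco

/-- The closure part of `ConfluentOn` keeps every reduction from `s` within rank one. -/
theorem confluentAt_of_rank_eq_one {R : TRS S V} {𝕃 : Set (Ctx S V)}
    (h : ConfluentOn R.Step {t | rank 𝕃 t = 1}) {s : Term S V} (hs : rank 𝕃 s = 1) :
    ConfluentAt R s := by
  have lift : ∀ t, RSteps R s t → rank 𝕃 t = 1 ∧ Relation.ReflTransGen
      (fun a b => R.Step a b ∧ rank 𝕃 a = 1 ∧ rank 𝕃 b = 1) s t := by
    intro t ht
    induction ht with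
    | refl => exact ⟨hs, Relation.ReflTransGen.refl⟩
    | tail _ h' ih =>
      have h1 := step_iff_rstep.2 h'
      have h2 := h.1 _ _ ih.1 h1
      exact ⟨h2, ih.2.tail ⟨h1, ih.1, h2⟩⟩
  have drop : ∀ {a b : Term S V}, Relation.ReflTransGen
      (fun a b => R.Step a b ∧ rank 𝕃 a = 1 ∧ rank 𝕃 b = 1) a b → RSteps R a b :=
    fun h => h.lift id fun _ _ h' => step_iff_rstep.1 h'.1
  intro b c hb hc
  obtain ⟨d, h1, h2⟩ := h.2 s b c (lift b hb).2 (lift c hc).2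
  exact ⟨d, drop h1, drop h2⟩

theorem confluent_of_boundedDuplicating [Infinite V] {R : TRS S V} {𝕃 : Set (Ctx S V)}
    (h𝕃 : IsLayerSystem 𝕃) (hW : WeaklyLayered R 𝕃)
    (hconf : ConfluentOn R.Step {t | rank 𝕃 t = 1}) (hB : BoundedDuplicating R) :
    Confluent R.Step := by
  have key : ∀ r : ℕ, ∀ s, rank 𝕃 s ≤ r + 1 → ConfluentAt R s := by
    intro r
    induction r with
    | zero =>
      intro s hs
      exact confluentAt_of_rank_eq_one hconf (le_antisymm hs (one_le_rank 𝕃 s))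
    | succ r ih =>
      intro s hs
      obtain ⟨D, hD⟩ := Deco.exists_isMax h𝕃 s
      exact Deco.confluentAt_succ h𝕃 hW hB (Nat.le_add_left 1 r) ih _ s D hD hs rfl
  rw [step_eq_rstep]
  intro a b c
  exact key (rank 𝕃 a) a (Nat.le_succ _) b c

/-! ### Non-duplicating systems -/

namespace Term

/-- The number of occurrences of the fresh symbol. -/
def countFresh {k : ℕ} : Term (S.adjoin k) V → ℕ
  | var _ => 0
  | app f ts => (Option.elim f 1 fun _ => 0) + ∑ i, (ts i).countFresh

/-- A common `F` for both sides of a rule allows the two sums to be compared summand by summand. -/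
theorem countFresh_liftBind {k : ℕ} (σ : W → Term (S.adjoin k) V) (t : Term S W)
    {F : Finset W} (hF : t.vars ⊆ F) :
    (t.liftBind k σ).countFresh = ∑ x ∈ F, t.countVar x * (σ x).countFresh := by
  induction t with
  | var y =>
    classical
    have hy : y ∈ F := hF rfl
    rw [Finset.sum_eq_single_of_mem y hy]
    · simp [liftBind, countVar]
    · intro x _ hxy
      simp [countVar, hxy.symm]
  | app f ts ih =>
    have h1 : ∀ i, ((ts i).liftBind k σ).countFresh
        = ∑ x ∈ F, (ts i).countVar x * (σ x).countFresh := fun i =>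
      ih i fun x hx => hF (mem_vars_app.2 ⟨i, hx⟩)
    have h2 : ((app f ts).liftBind k σ).countFresh
        = 0 + ∑ i : Fin (S.arity f), ((ts i).liftBind k σ).countFresh := rfl
    rw [h2, zero_add, Finset.sum_congr rfl fun i _ => h1 i, Finset.sum_comm]
    refine Finset.sum_congr rfl fun x _ => ?_
    rw [countVar, Finset.sum_mul]

theorem countFresh_app_update {k : ℕ} (f : (S.adjoin k).Sym)
    (ts : Fin ((S.adjoin k).arity f) → Term (S.adjoin k) V) (i : Fin ((S.adjoin k).arity f))
    (t : Term (S.adjoin k) V) :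
    (app f (Function.update ts i t)).countFresh + (ts i).countFresh
      = (app f ts).countFresh + t.countFresh := by
  simp only [countFresh]
  rw [← Finset.add_sum_erase _ _ (Finset.mem_univ i),
    ← Finset.add_sum_erase Finset.univ (fun j => (ts j).countFresh) (Finset.mem_univ i),
    Finset.sum_congr rfl fun j hj => by
      rw [Function.update_of_ne (Finset.ne_of_mem_erase hj)], Function.update_self]
  omega

end Term

theorem countFresh_le_of_rstep {R : TRS S V} (hR : NonDuplicating R) {k : ℕ}
    {s t : Term (S.adjoin k) V} (h : RStep (R.lift k) s t) : t.countFresh ≤ s.countFresh := by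
  induction h with
  | @root ρ hρ σ =>
    obtain ⟨ρ, hρ', rfl⟩ := hρ
    simp only [Rule.lift, bind_lift]
    have hF : ρ.lhs.vars ⊆ ρ.lhs.finite_vars.toFinset := by simp
    rw [countFresh_liftBind σ _ hF, countFresh_liftBind σ _ (ρ.vars_subset.trans hF)]
    exact Finset.sum_le_sum fun x _ => Nat.mul_le_mul_right _ (hR ρ hρ' x)
  | app f ts i _ ih =>
    rename_i t _
    have := countFresh_app_update f ts i t
    omega

theorem countFresh_lt_of_diamond {s t : Term (S.adjoin 1) V} (h : RStep (diamondTRS (S := S) (V := V)) s t) :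
    t.countFresh < s.countFresh := by
  induction h with
  | root hρ σ =>
    obtain ⟨x, rfl⟩ := hρ
    have : ((diamondRule x).lhs.bind σ).countFresh
        = 1 + ∑ _i : Fin 1, (σ x : Term (S.adjoin 1) V).countFresh := rfl
    rw [this]
    simp [diamondRule, Term.bind]
  | app f ts i _ ih =>
    rename_i t _
    have := countFresh_app_update f ts i t
    omega

/-- The measure is the number of symbols `◊`: steps of `R` never increase it, and each step `◊(x) →
x` decreases it. -/
theorem boundedDuplicating_of_nonDuplicating {R : TRS S V} (hR : NonDuplicating R) :
    BoundedDuplicating R := by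
  have hle : ∀ a b : Term (S.adjoin 1) V, Relation.ReflTransGen (R.lift 1).Step a b →
      b.countFresh ≤ a.countFresh := by
    intro a b h
    induction h with
    | refl => exact le_rfl
    | tail _ h ih => exact (countFresh_le_of_rstep hR (step_iff_rstep.1 h)).trans ih
  have hlt : ∀ a b : Term (S.adjoin 1) V, RelStep diamondTRS (R.lift 1) a b →
      b.countFresh < a.countFresh := by
    rintro a b ⟨c, h1, d, h2, h3⟩
    exact (hle _ _ h3).trans_lt
      ((countFresh_lt_of_diamond (step_iff_rstep.1 h2)).trans_le (hle _ _ h1))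
  refine Subrelation.wf (r := fun b a : Term (S.adjoin 1) V => b.countFresh < a.countFresh)
    (fun {b a} h => ?_) (measure Term.countFresh).wf
  induction h with
  | single h => exact hlt _ _ h
  | tail _ h ih => exact (hlt _ _ h).trans ih

end LayerTRS

theorem mainTheorem3 {S : LayerTRS.Signature.{u}} {V : Type v} [Infinite V]
    (R : LayerTRS.TRS S V) (𝕃 : Set (LayerTRS.Ctx S V))
    (h𝕃 : LayerTRS.IsLayerSystem 𝕃)
    (hW : LayerTRS.WeaklyLayered R 𝕃)
    (hconf : LayerTRS.ConfluentOn R.Step {t | LayerTRS.rank 𝕃 t = 1}) :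
    (LayerTRS.BoundedDuplicating R → LayerTRS.Confluent R.Step) ∧
      (LayerTRS.NonDuplicating R →
        LayerTRS.BoundedDuplicating R ∧ LayerTRS.Confluent R.Step) := by
  have h := fun hB => LayerTRS.confluent_of_boundedDuplicating h𝕃 hW hconf hB
  exact ⟨h, fun hR => ⟨LayerTRS.boundedDuplicating_of_nonDuplicating hR,
    h (LayerTRS.boundedDuplicating_of_nonDuplicating hR)⟩⟩
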